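/- Let $s\in(0,1)$, let $n\in\mathbb N$ with $n>2s$, let $\Omega\subset\mathbb R^n$ be a bounded open set, and let $K:\mathbb R^n\setminus\{0\}\to(0,+\infty)$ be a function such that $x\mapsto \min\{|x|^2,1\}K(x)$ is in $L^1(\mathbb R^n)$ and, for some $\theta>0$, $K(x)\ge\theta|x|^{-(n+2s)}$ for all $x\neq0$. Let $X_0$ be the space of Lebesgue measurable functions $g:\mathbb R^n\to\mathbb R$ (modulo equality a.e.) with $g|_\Omega\in L^2(\Omega)$, with $(x,y)\mapsto(g(x)-g(y))\sqrt{K(x-y)}$ in $L^2\big((\mathbb R^n\times\mathbb R^n)\setminus((\mathbb R^n\setminus\Omega)\times(\mathbb R^n\setminus\Omega))\big)$, and with $g=0$ a.e. in $\mathbb R^n\setminus\Omega$, endowed with the scalar product $$\langle u,v\rangle_{X_0}=\int_{\mathbb R^n\times\mathbb R^n}(u(x)-u(y))(v(x)-v(y))K(x-y)\,dx\,dy$$ and the corresponding norm $\|\cdot\|_{X_0}$. Let $f:\Omega\times\mathbb R\to\mathbb R$ be a Carathéodory function (that is, $f(\cdot,t)$ is measurable for every $t\in\mathbb R$ and $f(x,\cdot)$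 is continuous for a.e. $x\in\Omega$), put $F(x,t)=\int_0^tf(x,\tau)\,d\tau$, and suppose that for some $q\in(2,2^*)$, where $2^*=2n/(n-2s)$: - there are $a_1,a_2>0$ with $|f(x,t)|\le a_1+a_2|t|^{q-1}$ for a.e. $x\in\Omega$ and all $t\in\mathbb R$; - there are $a_3,a_4>0$ with $F(x,t)\ge a_3|t|^q-a_4$ for a.e. $x\in\Omega$ and all $t\in\mathbb R$; - $\lim_{|t|\to0}f(x,t)/|t|=0$ uniformly in $x\in\Omega$; - $0<qF(x,t)\le tf(x,t)$ for a.e. $x\in\Omega$ and all $t\in\mathbb R\setminus\{0\}$. Let $\lambda>0$ and, for $u\in X_0$, $$\mathcal J_\lambda(u)=\frac12\int_{\mathbb R^n\times\mathbb R^n}|u(x)-u(y)|^2K(x-y)\,dx\,dy-\frac\lambda2\int_\Omega|u(x)|^2\,dx-\int_\Omega F(x,u(x))\,dx .$$ Then $F(\cdot,u(\cdot))$ is integrable on $\Omega$ for every $u\in X_0$, the functional $\mathcal J_\lambda:X_0\to\mathbb R$ is Fréchet differentiable, and $\mathcal J_\lambda$ satisfies the Palais–Smale condition at every level $c\in\mathbb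 R$: every sequence $(u_j)$ in $X_0$ such that $\mathcal J_\lambda(u_j)\to c$ and $\|\mathcal J_\lambda'(u_j)\|_{X_0'}\to0$ as $j\to+\infty$ (where $X_0'$ is the dual of $X_0$ with the dual norm) has a subsequence that converges in $X_0$. -/

import Mathlib

open MeasureTheory Filter Topology Set

noncomputable section

namespace NonlocalProblem

/-- The ambient space `ℝⁿ` with its Euclidean norm and Lebesgue measure. -/
abbrev Rn (n : ℕ) : Type := EuclideanSpace ℝ (Fin n)

/-- The function `(x, y) ↦ (g x - g y) √(K (x - y))`. -/
def weightedDiff {n : ℕ} (K : Rn n → ℝ) (g : Rn n → ℝ) (p : Rn n × Rn n) : ℝ :=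
  (g p.1 - g p.2) * √(K (p.1 - p.2))

/-- The form
`⟨u, v⟩ = ∫_{ℝⁿ × ℝⁿ} (u x - u y) (v x - v y) K (x - y) dx dy`. -/
def energyForm {n : ℕ} (K : Rn n → ℝ) (u v : Rn n → ℝ) : ℝ :=
  ∫ p : Rn n × Rn n, (u p.1 - u p.2) * (v p.1 - v p.2) * K (p.1 - p.2)

/-- The assumptions on the order `s`, the dimension `n`, the domain `Ω` and the kernel `K`.
Only the values of `K` away from the origin matter. -/
structure Standing (n : ℕ) (s : ℝ) (Ω : Set (Rn n)) (K : Rn n → ℝ) : Prop where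
  s_pos : 0 < s
  s_lt_one : s < 1
  two_s_lt : 2 * s < n
  isOpen : IsOpen Ω
  isBounded : Bornology.IsBounded Ω
  kernel_pos : ∀ x, x ≠ 0 → 0 < K x
  kernel_integrable : Integrable (fun x => min (‖x‖ ^ 2) 1 * K x)
  kernel_lower : ∃ θ : ℝ, 0 < θ ∧ ∀ x, x ≠ 0 → θ * ‖x‖ ^ (-((n : ℝ) + 2 * s)) ≤ K x

section lemmas

variable {n : ℕ} {K : Rn n → ℝ}

lemma comp_fst_ae {f g : Rn n → ℝ} (h : f =ᵐ[volume] g) :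
    (fun p : Rn n × Rn n => f p.1) =ᵐ[volume] fun p => g p.1 :=
  (Measure.quasiMeasurePreserving_fst (μ := (volume : Measure (Rn n)))
    (ν := (volume : Measure (Rn n)))).ae_eq_comp h

lemma comp_snd_ae {f g : Rn n → ℝ} (h : f =ᵐ[volume] g) :
    (fun p : Rn n × Rn n => f p.2) =ᵐ[volume] fun p => g p.2 :=
  (Measure.quasiMeasurePreserving_snd (μ := (volume : Measure (Rn n)))
    (ν := (volume : Measure (Rn n)))).ae_eq_comp h

lemma weightedDiff_congr {f g : Rn n → ℝ} (h : f =ᵐ[volume] g) :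
    weightedDiff K f =ᵐ[volume] weightedDiff K g := by
  filter_upwards [comp_fst_ae h, comp_snd_ae h] with p h1 h2
  simp only [weightedDiff, h1, h2]

lemma weightedDiff_zero : weightedDiff K (0 : Rn n → ℝ) = 0 := by
  funext p; simp [weightedDiff]

lemma weightedDiff_add (f g : Rn n → ℝ) :
    weightedDiff K (f + g) = weightedDiff K f + weightedDiff K g := by
  funext p; simp only [weightedDiff, Pi.add_apply]; ring

lemma weightedDiff_smul (c : ℝ) (f : Rn n → ℝ) :
    weightedDiff K (c • f) = c • weightedDiff K f := by
  funext p; simp only [weightedDiff, Pi.smul_apply, smul_eq_mul]; ring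

end lemmas

/-- The linear space `X₀` of the (classes modulo equality almost everywhere of) Lebesgue
measurable `g : ℝⁿ → ℝ` with `g ∈ L²(Ω)`, with `(x, y) ↦ (g x - g y) √(K (x - y))` in
`L²(ℝⁿ × ℝⁿ \ (Ωᶜ × Ωᶜ))`, and with `g = 0` almost everywhere outside `Ω`. -/
def X0Submodule {n : ℕ} (Ω : Set (Rn n)) (K : Rn n → ℝ) :
    Submodule ℝ (Rn n →ₘ[volume] ℝ) where
  carrier := {g | MemLp g 2 (volume.restrict Ω) ∧
    MemLp (weightedDiff K g) 2 (volume.restrict (Ωᶜ ×ˢ Ωᶜ)ᶜ) ∧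
    ∀ᵐ x ∂(volume.restrict Ωᶜ), g x = 0}
  zero_mem' := by
    have h0 : ((0 : Rn n →ₘ[volume] ℝ) : Rn n → ℝ) =ᵐ[volume] 0 := AEEqFun.coeFn_zero
    refine ⟨(memLp_congr_ae (ae_restrict_of_ae h0)).2 MemLp.zero, ?_, ae_restrict_of_ae h0⟩
    refine (memLp_congr_ae (ae_restrict_of_ae (weightedDiff_congr h0))).2 ?_
    rw [weightedDiff_zero]
    exact MemLp.zero
  add_mem' := by
    rintro a b ⟨a1, a2, a3⟩ ⟨b1, b2, b3⟩
    have h0 := AEEqFun.coeFn_add a b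
    refine ⟨(memLp_congr_ae (ae_restrict_of_ae h0)).2 (a1.add b1), ?_, ?_⟩
    · refine (memLp_congr_ae (ae_restrict_of_ae (weightedDiff_congr h0))).2 ?_
      rw [weightedDiff_add]
      exact a2.add b2
    · filter_upwards [a3, b3, ae_restrict_of_ae h0] with x h1 h2 h3
      simp [h3, h1, h2]
  smul_mem' := by
    rintro c a ⟨a1, a2, a3⟩
    have h0 := AEEqFun.coeFn_smul c a
    refine ⟨(memLp_congr_ae (ae_restrict_of_ae h0)).2 (a1.const_smul c), ?_, ?_⟩
    · refine (memLp_congr_ae (ae_restrict_of_ae (weightedDiff_congr h0))).2 ?_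
      rw [weightedDiff_smul]
      exact a2.const_smul c
    · filter_upwards [a3, ae_restrict_of_ae h0] with x h1 h3
      simp [h3, h1]

/-- The space `X₀` attached to data that satisfy the standing assumptions. -/
def X0 {n : ℕ} {s : ℝ} {Ω : Set (Rn n)} {K : Rn n → ℝ} (_h : Standing n s Ω K) : Type :=
  X0Submodule Ω K

namespace X0

variable {n : ℕ} {s : ℝ} {Ω : Set (Rn n)} {K : Rn n → ℝ} {h : Standing n s Ω K}

/-- A representative of an element of `X₀`, as a function on `ℝⁿ`. -/
instance : CoeFun (X0 h) (fun _ => Rn n → ℝ) := ⟨fun u => (u.1 : Rn n → ℝ)⟩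

instance instAddCommGroup : AddCommGroup (X0 h) :=
  inferInstanceAs (AddCommGroup (X0Submodule Ω K))

instance instModule : Module ℝ (X0 h) :=
  inferInstanceAs (Module ℝ (X0Submodule Ω K))

lemma coe_add (u v : X0 h) : ((u + v : X0 h) : Rn n → ℝ) =ᵐ[volume] (u : Rn n → ℝ) + v :=
  AEEqFun.coeFn_add u.1 v.1

lemma coe_smul (c : ℝ) (u : X0 h) : ((c • u : X0 h) : Rn n → ℝ) =ᵐ[volume] c • (u : Rn n → ℝ) :=
  AEEqFun.coeFn_smul c u.1

lemma measurableSet_compl_prod (h : Standing n s Ω K) :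
    MeasurableSet (Ωᶜ ×ˢ Ωᶜ : Set (Rn n × Rn n)) :=
  h.isOpen.measurableSet.compl.prod h.isOpen.measurableSet.compl

lemma ae_zero (u : X0 h) : ∀ᵐ x, x ∈ Ωᶜ → u x = 0 :=
  (ae_restrict_iff' h.isOpen.measurableSet.compl).1 u.2.2.2

/-- On the whole of `ℝⁿ × ℝⁿ` the weighted difference of an element of `X₀` is in `L²`. -/
lemma memLp_weightedDiff (u : X0 h) : MemLp (weightedDiff K u) 2 volume := by
  have hS := measurableSet_compl_prod h
  have h1 : MemLp ((Ωᶜ ×ˢ Ωᶜ : Set (Rn n × Rn n))ᶜ.indicator (weightedDiff K u)) 2 volume :=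
    (memLp_indicator_iff_restrict hS.compl).2 u.2.2.1
  refine (memLp_congr_ae ?_).1 h1
  have hz := ae_zero u
  have hf : ∀ᵐ p : Rn n × Rn n, p.1 ∈ Ωᶜ → u p.1 = 0 :=
    (Measure.quasiMeasurePreserving_fst (μ := (volume : Measure (Rn n)))
      (ν := (volume : Measure (Rn n)))).ae hz
  have hs : ∀ᵐ p : Rn n × Rn n, p.2 ∈ Ωᶜ → u p.2 = 0 :=
    (Measure.quasiMeasurePreserving_snd (μ := (volume : Measure (Rn n)))
      (ν := (volume : Measure (Rn n)))).ae hz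
  filter_upwards [hf, hs] with p h1 h2
  by_cases hp : p ∈ (Ωᶜ ×ˢ Ωᶜ : Set (Rn n × Rn n))
  · rw [indicator_of_notMem (by simpa using hp)]
    simp [weightedDiff, h1 hp.1, h2 hp.2]
  · rw [indicator_of_mem (by simpa using hp)]

lemma weightedDiff_mul (h : Standing n s Ω K) (u v : Rn n → ℝ) (p : Rn n × Rn n) :
    weightedDiff K u p * weightedDiff K v p =
      (u p.1 - u p.2) * (v p.1 - v p.2) * K (p.1 - p.2) := by
  by_cases hp : p.1 = p.2
  · simp [weightedDiff, hp]
  · have hK := (h.kernel_pos _ (sub_ne_zero.2 hp)).le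
    simp only [weightedDiff]
    calc _ = (u p.1 - u p.2) * (v p.1 - v p.2) * (√(K (p.1 - p.2)) * √(K (p.1 - p.2))) := by ring
      _ = _ := by rw [Real.mul_self_sqrt hK]

lemma energyForm_eq (h : Standing n s Ω K) (u v : Rn n → ℝ) :
    energyForm K u v = ∫ p, weightedDiff K u p * weightedDiff K v p := by
  simp only [weightedDiff_mul h, energyForm]

lemma integrable_mul (u v : X0 h) :
    Integrable (fun p => weightedDiff K u p * weightedDiff K v p) volume :=
  (memLp_weightedDiff u).integrable_mul (memLp_weightedDiff v)

lemma volume_compl_ne_zero (h : Standing n s Ω K) : volume Ωᶜ ≠ 0 := by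
  have hn : 0 < n := by
    have h1 := h.s_pos
    have h2 := h.two_s_lt
    have : (0 : ℝ) < n := by linarith
    exact_mod_cast this
  have : Nonempty (Fin n) := ⟨⟨0, hn⟩⟩
  have : Nontrivial (Rn n) := inferInstance
  have : NoncompactSpace (Rn n) := NormedSpace.noncompactSpace ℝ (Rn n)
  intro h0
  have h1 : volume (univ : Set (Rn n)) = ⊤ := measure_univ_of_isAddLeftInvariant _
  have h2 : volume (univ : Set (Rn n)) ≤ volume Ω + volume Ωᶜ := by
    rw [← union_compl_self Ω]; exact measure_union_le _ _
  rw [h1, h0, add_zero] at h2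
  exact absurd h.isBounded.measure_lt_top (not_lt.2 h2)

lemma eq_zero_of_energyForm (u : X0 h) (hu : energyForm K u u = 0) : u = 0 := by
  rw [energyForm_eq h, integral_eq_zero_iff_of_nonneg (fun p => mul_self_nonneg _)
    (integrable_mul u u)] at hu
  have h1 : ∀ᵐ p : Rn n × Rn n, u p.1 = u p.2 := by
    filter_upwards [hu] with p hp
    by_cases hd : p.1 = p.2
    · rw [hd]
    · have hK := Real.sqrt_pos.2 (h.kernel_pos _ (sub_ne_zero.2 hd))
      have := mul_self_eq_zero.1 hp
      rcases mul_eq_zero.1 this with h' | h'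
      · exact sub_eq_zero.1 h'
      · exact absurd h' hK.ne'
  have h2 : ∀ᵐ x : Rn n, ∀ᵐ y : Rn n, u x = u y := Measure.ae_ae_of_ae_prod h1
  have h3 : ∀ᵐ x : Rn n, u x = 0 := by
    filter_upwards [h2] with x hx
    by_contra hne
    apply volume_compl_ne_zero h
    rw [measure_eq_zero_iff_ae_notMem]
    filter_upwards [hx, ae_zero u] with y hy hz hmem
    exact hne (hy.trans (hz hmem))
  apply Subtype.ext
  change u.1 = (0 : Rn n →ₘ[volume] ℝ)
  apply AEEqFun.ext
  filter_upwards [h3, (AEEqFun.coeFn_zero : ((0 : Rn n →ₘ[volume] ℝ) : Rn n → ℝ) =ᵐ[volume] 0)]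
    with x hx h0
  rw [hx, h0, Pi.zero_apply]

/-- The scalar product of `X₀`,
`⟨u, v⟩ = ∫_{ℝⁿ × ℝⁿ} (u x - u y) (v x - v y) K (x - y) dx dy`. -/
@[reducible] def innerCore : InnerProductSpace.Core ℝ (X0 h) where
  inner u v := energyForm K u v
  conj_inner_symm u v := by
    simp only [energyForm, conj_trivial]
    congr 1; funext p; ring
  re_inner_nonneg u := by
    change 0 ≤ energyForm K u u
    rw [energyForm_eq h]
    exact integral_nonneg fun p => mul_self_nonneg _
  add_left u v w := by
    change energyForm K _ w = energyForm K u w + energyForm K v w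
    rw [energyForm_eq h, energyForm_eq h, energyForm_eq h,
      ← integral_add (integrable_mul u w) (integrable_mul v w)]
    apply integral_congr_ae
    filter_upwards [weightedDiff_congr (K := K) (coe_add u v)] with p hp
    rw [hp, weightedDiff_add, Pi.add_apply]; ring
  smul_left u v c := by
    change energyForm K _ v = c * energyForm K u v
    rw [energyForm_eq h, energyForm_eq h, ← integral_const_mul]
    apply integral_congr_ae
    filter_upwards [weightedDiff_congr (K := K) (coe_smul c u)] with p hp
    rw [hp, weightedDiff_smul, Pi.smul_apply, smul_eq_mul]; ring
  definite u hu := eq_zero_of_energyForm u hu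

/-- `X₀` with the norm
`‖g‖ = (∫_{ℝⁿ × ℝⁿ} |g x - g y|² K (x - y) dx dy)^{1/2}` of its scalar product. -/
instance instNormedAddCommGroup : NormedAddCommGroup (X0 h) :=
  InnerProductSpace.Core.toNormedAddCommGroup (𝕜 := ℝ) (cd := innerCore)

instance instInnerProductSpace : InnerProductSpace ℝ (X0 h) :=
  InnerProductSpace.ofCore innerCore.toCore

lemma inner_def (u v : X0 h) : inner ℝ u v = energyForm K u v := rfl

lemma norm_def (u : X0 h) :
    ‖u‖ = √(∫ p : Rn n × Rn n, |u p.1 - u p.2| ^ 2 * K (p.1 - p.2)) := by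
  rw [norm_eq_sqrt_real_inner, inner_def]
  simp only [energyForm, sq_abs]
  simp only [sq]

end X0

/-- The primitive `F(x, t) = ∫₀ᵗ f(x, τ) dτ`. -/
def primitive {n : ℕ} (f : Rn n → ℝ → ℝ) (x : Rn n) (t : ℝ) : ℝ := ∫ τ in (0 : ℝ)..t, f x τ

/-- The assumptions on the nonlinearity `f`, with the exponent `q`; only the values of `f` on
`Ω × ℝ` matter. -/
structure Nonlinearity (n : ℕ) (s : ℝ) (Ω : Set (Rn n)) (q : ℝ) (f : Rn n → ℝ → ℝ) : Prop where
  /-- Carathéodory: measurable in `x` for each `t`, continuous in `t` for almost every `x`. -/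
  measurable : ∀ t, AEMeasurable (fun x => f x t) (volume.restrict Ω)
  continuous : ∀ᵐ x ∂(volume.restrict Ω), Continuous (f x)
  /-- `2 < q < 2*`, where `2* = 2 n / (n - 2 s)`. -/
  two_lt : 2 < q
  lt_critical : q < 2 * n / (n - 2 * s)
  growth : ∃ a₁ a₂ : ℝ, 0 < a₁ ∧ 0 < a₂ ∧
    ∀ᵐ x ∂(volume.restrict Ω), ∀ t, |f x t| ≤ a₁ + a₂ * |t| ^ (q - 1)
  primitive_lower : ∃ a₃ a₄ : ℝ, 0 < a₃ ∧ 0 < a₄ ∧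
    ∀ᵐ x ∂(volume.restrict Ω), ∀ t, a₃ * |t| ^ q - a₄ ≤ primitive f x t
  /-- `f(x, t) / |t| → 0` as `t → 0`, uniformly in `x ∈ Ω`. -/
  small_at_zero : TendstoUniformlyOn (fun t x => f x t / |t|) (fun _ => 0) (𝓝[≠] 0) Ω
  superlinear : ∀ᵐ x ∂(volume.restrict Ω), ∀ t, t ≠ 0 →
    0 < q * primitive f x t ∧ q * primitive f x t ≤ t * f x t

/-- The energy functional
`J_λ(u) = ½ ∫∫ |u x - u y|² K(x - y) dx dy - (λ/2) ∫_Ω |u|² dx - ∫_Ω F(x, u x) dx` on `X₀`. -/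
def energy {n : ℕ} {s : ℝ} {Ω : Set (Rn n)} {K : Rn n → ℝ} (h : Standing n s Ω K)
    (lam : ℝ) (f : Rn n → ℝ → ℝ) (u : X0 h) : ℝ :=
  1 / 2 * (∫ p : Rn n × Rn n, |u p.1 - u p.2| ^ 2 * K (p.1 - p.2))
    - lam / 2 * (∫ x in Ω, |u x| ^ 2) - ∫ x in Ω, primitive f x (u x)

/-- A Palais–Smale sequence of the functional `J` at the level `c`: `J(u_j) → c`, and the
Fréchet derivatives `J'(u_j)` tend to `0` in the norm of the dual space. -/
def IsPalaisSmaleSeq {E : Type*} [NormedAddCommGroup E] [NormedSpace ℝ E]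
    (J : E → ℝ) (c : ℝ) (u : ℕ → E) : Prop :=
  Tendsto (fun j => J (u j)) atTop (𝓝 c) ∧
    Tendsto (fun j => ‖fderiv ℝ J (u j)‖) atTop (𝓝 0)

/-- The Palais–Smale condition at the level `c`: every Palais–Smale sequence at the level `c`
has a subsequence that converges in norm. -/
def PalaisSmaleCondition {E : Type*} [NormedAddCommGroup E] [NormedSpace ℝ E]
    (J : E → ℝ) (c : ℝ) : Prop :=
  ∀ u : ℕ → E, IsPalaisSmaleSeq J c u →
    ∃ (φ : ℕ → ℕ) (v : E), StrictMono φ ∧ Tendsto (fun j => u (φ j)) atTop (𝓝 v)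

end NonlocalProblem

end

/-!
The nonlinear part of the energy only sees `u` through `L^q(Ω)`. On that space the functional
`w ↦ ∫_Ω G(x, w)` is Fréchet differentiable, because of the growth of order `q - 1` of its density
(`GrowthFunction.exists_hasFDerivAt_integral_primitive`). The quadratic term `λ |u|² / 2` is put
into `G`, so that the energy is `‖u‖² / 2` minus such a functional, composed with the embedding of
`X₀` in `L^q(Ω)`.

The analytic core is the compactness of this embedding for `q < 2*`. The lower bound on the kernel
shows that the distance of `u x` to its average over the ball of radius `ρ` around `x` is at most
`C ρ ^ s` times the square root of `∫ |u x - u y|² K(x - y) dy` (`X0.sq_sub_setAverage_le`).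
Two facts follow from this one estimate.

* Choosing `ρ` depending on `x` gives the Sobolev inequality `‖u‖_{L^{2*}} ≤ C ‖u‖`, for bounded
  truncations of `u` and then in the limit (`X0.exists_eLpNorm_criticalExponent_le`).
* For a bounded sequence in `X₀` which converges weakly in `L²(ℝⁿ)`, the averages converge, and a
  small `ρ` makes the remaining part small. Hence it is a Cauchy sequence in `L²(Ω)`, and by
  interpolation with `L^{2*}` also in `L^q(Ω)` (`X0.exists_subseq_cauchySeq`).

A Palais–Smale sequence `u_j` is bounded: in `J(u) - κ J'(u) u`, with `1 / q < κ < 1 / 2`, the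
superlinearity `q F ≤ t f` and the lower bound on `F` leave a positive multiple of `‖u‖²` up to a
constant (`X0.exists_norm_sq_le`). After passing to a subsequence which is Cauchy in `L^q(Ω)`, the
identity `‖u_j - u_k‖² = (J'(u_j) - J'(u_k))(u_j - u_k) + ∫_Ω (g(x, u_j) - g(x, u_k)) (u_j - u_k)`,
where `g` is the density of the nonlinear part, shows that it is Cauchy in `X₀`
(`X0.palaisSmaleCondition_energy`), and `X₀` is complete (`X0.instCompleteSpace`).
-/

namespace NonlocalProblem

/-! ### An elementary interpolation inequality -/

/-- An intermediate power is controlled by a small multiple of a higher power and a large multiple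
of a lower one. -/
lemma exists_rpow_le_mul_rpow_add {a b c : ℝ} (hab : a ≤ b) (hbc : b < c) {δ : ℝ} (hδ : 0 < δ) :
    ∃ C : ℝ, 0 < C ∧ ∀ t : ℝ, 0 < t → t ^ b ≤ δ * t ^ c + C * t ^ a := by
  have hcb : 0 < c - b := sub_pos.2 hbc
  -- The threshold above which `t ^ b ≤ δ t ^ c`.
  set T : ℝ := (δ⁻¹) ^ (c - b)⁻¹ with hT
  have hT0 : 0 < T := Real.rpow_pos_of_pos (inv_pos.2 hδ) _
  have hTc : T ^ (c - b) = δ⁻¹ := by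
    rw [hT, ← Real.rpow_mul (inv_pos.2 hδ).le, inv_mul_cancel₀ hcb.ne', Real.rpow_one]
  refine ⟨T ^ (b - a), Real.rpow_pos_of_pos hT0 _, fun t ht => ?_⟩
  have h1 : 0 ≤ t ^ a := Real.rpow_nonneg ht.le _
  have h2 : 0 ≤ t ^ b := Real.rpow_nonneg ht.le _
  have h3 : 0 ≤ t ^ c := Real.rpow_nonneg ht.le _
  rcases le_total t T with h | h
  · have : t ^ b = t ^ (b - a) * t ^ a := by rw [← Real.rpow_add ht]; ring_nf
    have h4 : t ^ (b - a) ≤ T ^ (b - a) := Real.rpow_le_rpow ht.le h (sub_nonneg.2 hab)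
    nlinarith [mul_le_mul_of_nonneg_right h4 h1, mul_nonneg hδ.le h3]
  · have : t ^ c = t ^ (c - b) * t ^ b := by rw [← Real.rpow_add ht]; ring_nf
    have h4 : T ^ (c - b) ≤ t ^ (c - b) := Real.rpow_le_rpow hT0.le h hcb.le
    rw [hTc] at h4
    have h5 : 1 ≤ δ * t ^ (c - b) := by
      have := mul_le_mul_of_nonneg_left h4 hδ.le
      rwa [mul_inv_cancel₀ hδ.ne'] at this
    have h6 := mul_le_mul_of_nonneg_right h5 h2
    have h7 : 0 ≤ T ^ (b - a) * t ^ a := mul_nonneg (Real.rpow_nonneg hT0.le _) h1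
    rw [this]
    linarith

/-! ### Superposition operators on Lebesgue spaces -/

section Superposition

variable {α : Type*} [MeasurableSpace α]

/-- A jointly measurable function, continuous in its second variable and of growth at most
`a + b |t| ^ (q - 1)`, without exceptional points. -/
structure GrowthFunction (q a b : ℝ) (f : α → ℝ → ℝ) : Prop where
  measurable_uncurry : Measurable (Function.uncurry f)
  continuous : ∀ x, Continuous (f x)
  nonneg_left : 0 ≤ a
  nonneg_right : 0 ≤ b
  growth : ∀ x t, |f x t| ≤ a + b * |t| ^ (q - 1)

/-- A Carathéodory function agrees, outside a null set of points, with a function which is jointly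
measurable and satisfies the continuity and growth conditions everywhere. -/
lemma exists_growthFunction {μ : Measure α} {q a b : ℝ} {f : α → ℝ → ℝ} (ha : 0 ≤ a) (hb : 0 ≤ b)
    (hm : ∀ t, AEMeasurable (fun x => f x t) μ) (hc : ∀ᵐ x ∂μ, Continuous (f x))
    (hg : ∀ᵐ x ∂μ, ∀ t, |f x t| ≤ a + b * |t| ^ (q - 1)) :
    ∃ g : α → ℝ → ℝ, GrowthFunction q a b g ∧ ∀ᵐ x ∂μ, f x = g x := by
  classical
  have hr : ∀ᵐ x ∂μ, ∀ r : ℚ, f x r = (hm r).mk _ x :=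
    ae_all_iff.2 fun r => (hm r).ae_eq_mk
  obtain ⟨N, hN, hNm, hN0⟩ := exists_measurable_superset_of_null (ae_iff.1 (hc.and (hg.and hr)))
  set A : Set α := Nᶜ with hAdef
  have hAm : MeasurableSet A := hNm.compl
  have hAae : ∀ᵐ x ∂μ, x ∈ A := by
    rw [ae_iff]; simpa [hAdef] using hN0
  have hA : ∀ x ∈ A, Continuous (f x) ∧ (∀ t, |f x t| ≤ a + b * |t| ^ (q - 1)) ∧
      ∀ r : ℚ, f x r = (hm r).mk _ x := by
    intro x hx
    by_contra hcon
    exact hx (hN hcon)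
  refine ⟨fun x t => if x ∈ A then f x t else 0, ⟨?_, ?_, ha, hb, ?_⟩, ?_⟩
  · have hmeas : ∀ t, Measurable fun x => if x ∈ A then f x t else 0 := by
      intro t
      obtain ⟨r, -, -, hr⟩ :=
        (Rat.denseRange_cast (𝕜 := ℝ)).exists_seq_strictAnti_tendsto Rat.cast_strictMono.monotone t
      refine measurable_of_tendsto_metrizable
        (f := fun k x => if x ∈ A then (hm (r k)).mk _ x else 0) (fun k => ?_)
        (tendsto_pi_nhds.2 fun x => ?_)
      · exact Measurable.ite hAm (hm (r k)).measurable_mk measurable_const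
      · by_cases hx : x ∈ A
        · simp only [hx, if_true]
          simp_rw [← (hA x hx).2.2]
          exact ((hA x hx).1.tendsto t).comp hr
        · simp [hx]
    have hcont : ∀ x, Continuous fun t => if x ∈ A then f x t else 0 := by
      intro x
      by_cases hx : x ∈ A
      · simpa [hx] using (hA x hx).1
      · simpa [hx] using continuous_const
    have := measurable_uncurry_of_continuous_of_measurable
      (u := fun t x => if x ∈ A then f x t else 0) hcont hmeas
    exact this.comp measurable_swap
  · intro x
    by_cases hx : x ∈ A
    · simpa [hx] using (hA x hx).1
    · simpa [hx] using continuous_const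
  · intro x t
    by_cases hx : x ∈ A
    · simpa [hx] using (hA x hx).2.1 t
    · simpa [hx] using add_nonneg ha (mul_nonneg hb (Real.rpow_nonneg (abs_nonneg t) _))
  · filter_upwards [hAae] with x hx
    simp [hx]

end Superposition

section Superposition

variable {n : ℕ} {q a b : ℝ} {g : Rn n → ℝ → ℝ} {μ : Measure (Rn n)}

namespace GrowthFunction

lemma hasDerivAt_primitive (hg : GrowthFunction q a b g) (x : Rn n) (t : ℝ) :
    HasDerivAt (primitive g x) (g x t) t :=
  ((hg.continuous x).integral_hasStrictDerivAt 0 t).hasDerivAt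

lemma measurable_uncurry_primitive (hg : GrowthFunction q a b g) :
    Measurable (Function.uncurry (primitive g)) := by
  have hcont : ∀ x, Continuous (primitive g x) := fun x =>
    continuous_iff_continuousAt.2 fun t => (hg.hasDerivAt_primitive x t).continuousAt
  have hmeas : ∀ t, Measurable fun x => primitive g x t := by
    intro t
    simp only [primitive, intervalIntegral]
    exact (hg.measurable_uncurry.stronglyMeasurable.integral_prod_right'.sub
      hg.measurable_uncurry.stronglyMeasurable.integral_prod_right').measurable
  exact (measurable_uncurry_of_continuous_of_measurable
    (u := fun t x => primitive g x t) hcont hmeas).comp measurable_swap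

lemma abs_primitive_add_sub_le (hg : GrowthFunction q a b g) (hq : 1 ≤ q) (x : Rn n) {r t m : ℝ}
    (hm : |r| + |t| ≤ m) :
    |primitive g x (r + t) - primitive g x r| ≤ (a + b * m ^ (q - 1)) * |t| := by
  have hi : ∀ c d : ℝ, IntervalIntegrable (g x) volume c d :=
    fun c d => (hg.continuous x).intervalIntegrable c d
  have h1 : primitive g x (r + t) - primitive g x r = ∫ τ in r..(r + t), g x τ :=
    intervalIntegral.integral_interval_sub_left (hi _ _) (hi _ _)
  rw [h1, ← Real.norm_eq_abs]
  refine (intervalIntegral.norm_integral_le_of_norm_le_const (C := a + b * m ^ (q - 1)) ?_).trans ?_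
  · intro τ hτ
    have hτm : |τ| ≤ m := by
      have h2 := abs_sub_left_of_mem_uIcc (uIoc_subset_uIcc hτ)
      have h3 : |τ| ≤ |r| + |τ - r| := by
        calc |τ| = |r + (τ - r)| := by ring_nf
          _ ≤ _ := abs_add_le _ _
      rw [add_sub_cancel_left] at h2
      linarith
    refine (hg.growth x τ).trans ?_
    have := Real.rpow_le_rpow (abs_nonneg τ) hτm (sub_nonneg.2 hq)
    have := mul_le_mul_of_nonneg_left this hg.nonneg_right
    linarith
  · rw [add_sub_cancel_left]

lemma aestronglyMeasurable_comp (hg : GrowthFunction q a b g) {u : Rn n → ℝ}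
    (hu : AEStronglyMeasurable u μ) : AEStronglyMeasurable (fun x => g x (u x)) μ :=
  (hg.measurable_uncurry.comp_aemeasurable
    (aemeasurable_id.prodMk hu.aemeasurable)).aestronglyMeasurable

lemma aestronglyMeasurable_primitive_comp (hg : GrowthFunction q a b g) {u : Rn n → ℝ}
    (hu : AEStronglyMeasurable u μ) : AEStronglyMeasurable (fun x => primitive g x (u x)) μ :=
  (hg.measurable_uncurry_primitive.comp_aemeasurable
    (aemeasurable_id.prodMk hu.aemeasurable)).aestronglyMeasurable

/-- The superposition operator maps `L^q` to the dual space `L^{q / (q - 1)}`. -/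
lemma memLp_comp [IsFiniteMeasure μ] (hg : GrowthFunction q a b g) (hq : 1 < q) {u : Rn n → ℝ}
    (hu : MemLp u (ENNReal.ofReal q) μ) :
    MemLp (fun x => g x (u x)) (ENNReal.ofReal q.conjExponent) μ := by
  have h1 : MemLp (fun x => |u x| ^ (q - 1)) (ENNReal.ofReal q.conjExponent) μ := by
    have := hu.norm_rpow_div (ENNReal.ofReal (q - 1))
    rw [ENNReal.toReal_ofReal (by linarith), ← ENNReal.ofReal_div_of_pos (by linarith)] at this
    exact this
  refine ((memLp_const (μ := μ) a).add (h1.const_mul b)).mono'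
    (hg.aestronglyMeasurable_comp hu.1) (Eventually.of_forall fun x => ?_)
  simpa using hg.growth x (u x)

lemma integrable_comp_mul [IsFiniteMeasure μ] (hg : GrowthFunction q a b g) (hq : 1 < q)
    {u v : Rn n → ℝ} (hu : MemLp u (ENNReal.ofReal q) μ) (hv : MemLp v (ENNReal.ofReal q) μ) :
    Integrable (fun x => g x (u x) * v x) μ := by
  have := (Real.HolderConjugate.conjExponent hq).symm.ennrealOfReal
  exact (hg.memLp_comp hq hu).integrable_mul hv

lemma integrable_primitive_comp [IsFiniteMeasure μ] (hg : GrowthFunction q a b g) (hq : 1 < q)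
    {u : Rn n → ℝ} (hu : MemLp u (ENNReal.ofReal q) μ) :
    Integrable (fun x => primitive g x (u x)) μ := by
  -- The primitive is dominated by `|u| (a + b |u| ^ (q - 1))`, itself a superposition.
  have h1 : GrowthFunction q a b (fun (_ : Rn n) t => a + b * |t| ^ (q - 1)) := by
    refine ⟨?_, fun x => ?_, hg.nonneg_left, hg.nonneg_right, fun x t => ?_⟩
    · have : Measurable fun p : Rn n × ℝ => a + b * |p.2| ^ (q - 1) := by fun_prop
      exact this
    · exact continuous_const.add (continuous_const.mul
        (continuous_abs.rpow_const fun t => Or.inr (by linarith)))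
    · rw [abs_of_nonneg]
      exact add_nonneg hg.nonneg_left
        (mul_nonneg hg.nonneg_right (Real.rpow_nonneg (abs_nonneg t) _))
  refine (h1.integrable_comp_mul hq hu hu.norm).mono' (hg.aestronglyMeasurable_primitive_comp hu.1)
    (Eventually.of_forall fun x => ?_)
  have := hg.abs_primitive_add_sub_le hq.le x (r := 0) (t := u x) (m := |u x|) (by simp)
  simpa [primitive] using this

end GrowthFunction

/-- The difference quotient of the primitive of `g x` between `r` and `r + t`, minus the
derivative `g x r`. Since division by zero gives zero, it vanishes for `t = 0`. -/
noncomputable def primitiveRemainder (g : Rn n → ℝ → ℝ) (x : Rn n) (r t : ℝ) : ℝ :=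
  (primitive g x (r + t) - primitive g x r - g x r * t) / t

lemma primitiveRemainder_mul (g : Rn n → ℝ → ℝ) (x : Rn n) (r t : ℝ) :
    primitiveRemainder g x r t * t = primitive g x (r + t) - primitive g x r - g x r * t := by
  by_cases ht : t = 0
  · simp [primitiveRemainder, ht]
  · simp [primitiveRemainder, ht]

namespace GrowthFunction

lemma tendsto_primitiveRemainder (hg : GrowthFunction q a b g) (x : Rn n) (r : ℝ) :
    Tendsto (primitiveRemainder g x r) (𝓝 0) (𝓝 0) := by
  have h := hasDerivAt_iff_tendsto.1 (hg.hasDerivAt_primitive x r)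
  have h2 : Tendsto (fun t : ℝ => r + t) (𝓝 0) (𝓝 r) := by
    simpa using (continuous_const.add continuous_id).tendsto (x := (0 : ℝ)) (f := fun t => r + t)
  have h3 := h.comp h2

  refine squeeze_zero_norm (fun t => le_of_eq ?_) h3
  simp [primitiveRemainder, div_eq_inv_mul, mul_comm]

lemma abs_primitiveRemainder_rpow_le (hg : GrowthFunction q a b g) (hq : 1 < q) (x : Rn n)
    (r t : ℝ) :
    |primitiveRemainder g x r t| ^ q.conjExponent ≤
      (2 * (a + b * 2 ^ (q - 1))) ^ q.conjExponent * (1 + |r| ^ q + |t| ^ q) := by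
  have hq1 : 0 < q - 1 := by linarith
  have hc := Real.HolderConjugate.conjExponent hq
  set m : ℝ := max 1 (max |r| |t|) with hm
  have hm1 : 1 ≤ m := le_max_left _ _
  have hmr : |r| ≤ m := (le_max_left _ _).trans (le_max_right _ _)
  have hmt : |t| ≤ m := (le_max_right _ _).trans (le_max_right _ _)
  have hD : 0 ≤ a + b * 2 ^ (q - 1) :=
    add_nonneg hg.nonneg_left (mul_nonneg hg.nonneg_right (by positivity))
  have hmq : 1 ≤ m ^ (q - 1) := Real.one_le_rpow hm1 hq1.le
  have hb2 : 0 ≤ b * 2 ^ (q - 1) := mul_nonneg hg.nonneg_right (by positivity)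
  have h1 : |primitiveRemainder g x r t| ≤ 2 * (a + b * 2 ^ (q - 1)) * m ^ (q - 1) := by
    by_cases ht : t = 0
    · simp only [primitiveRemainder, ht, div_zero, abs_zero]; positivity
    have ht' : 0 < |t| := abs_pos.2 ht
    have e1 := hg.abs_primitive_add_sub_le hq.le x (r := r) (t := t) (m := 2 * m) (by linarith)
    have e2 := hg.growth x r
    have e3 : |r| ^ (q - 1) ≤ (2 * m) ^ (q - 1) :=
      Real.rpow_le_rpow (abs_nonneg _) (by linarith) hq1.le
    rw [Real.mul_rpow (by norm_num) (by linarith)] at e1 e3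
    rw [primitiveRemainder, abs_div, div_le_iff₀ ht']
    have e4 : |primitive g x (r + t) - primitive g x r - g x r * t| ≤
        |primitive g x (r + t) - primitive g x r| + |g x r| * |t| := by
      rw [← abs_mul]; exact abs_sub _ _
    have e5 : a + b * (2 ^ (q - 1) * m ^ (q - 1)) ≤ (a + b * 2 ^ (q - 1)) * m ^ (q - 1) := by
      nlinarith [hg.nonneg_left]
    have e6 : |g x r| ≤ (a + b * 2 ^ (q - 1)) * m ^ (q - 1) :=
      e2.trans (le_trans (by nlinarith [mul_le_mul_of_nonneg_left e3 hg.nonneg_right]) e5)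
    nlinarith [mul_le_mul_of_nonneg_right e5 ht'.le, mul_le_mul_of_nonneg_right e6 ht'.le]
  calc _ ≤ (2 * (a + b * 2 ^ (q - 1)) * m ^ (q - 1)) ^ q.conjExponent :=
        Real.rpow_le_rpow (abs_nonneg _) h1 hc.symm.nonneg
    _ = (2 * (a + b * 2 ^ (q - 1))) ^ q.conjExponent * m ^ q := by
        rw [Real.mul_rpow (by positivity) (by positivity), ← Real.rpow_mul (by linarith),
          hc.sub_one_mul_conj]
    _ ≤ _ := by
        refine mul_le_mul_of_nonneg_left ?_ (by positivity)
        have hr := Real.rpow_nonneg (abs_nonneg r) q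
        have ht := Real.rpow_nonneg (abs_nonneg t) q
        rcases max_choice 1 (max |r| |t|) with h | h
        · rw [hm, h, Real.one_rpow]; linarith
        · rw [hm, h]
          rcases max_choice |r| |t| with h | h <;> rw [h] <;> linarith

end GrowthFunction

lemma norm_Lp_rpow_eq [Fact (1 ≤ ENNReal.ofReal q)] (hq : 1 < q) (v : Lp ℝ (ENNReal.ofReal q) μ) :
    ‖v‖ ^ q = ∫ x, |v x| ^ q ∂μ := by
  have hq0 : 0 < q := by linarith
  have hnn : 0 ≤ ∫ x, |v x| ^ q ∂μ :=
    integral_nonneg fun x => Real.rpow_nonneg (abs_nonneg _) _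
  rw [Lp.norm_def, (Lp.memLp v).eLpNorm_eq_integral_rpow_norm (by simpa using hq0)
    ENNReal.ofReal_ne_top, ENNReal.toReal_ofReal hq0.le]
  simp only [Real.norm_eq_abs]
  rw [ENNReal.toReal_ofReal (Real.rpow_nonneg hnn _), ← Real.rpow_mul hnn,
    inv_mul_cancel₀ hq0.ne', Real.rpow_one]

/-- Hölder's inequality for the pairing of `L^{q / (q - 1)}` and `L^q`. -/
lemma abs_integral_mul_le [Fact (1 ≤ ENNReal.ofReal q)] (hq : 1 < q) {k : Rn n → ℝ}
    (hk : MemLp k (ENNReal.ofReal q.conjExponent) μ) (v : Lp ℝ (ENNReal.ofReal q) μ) :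
    |∫ x, k x * v x ∂μ| ≤ (∫ x, |k x| ^ q.conjExponent ∂μ) ^ (1 / q.conjExponent) * ‖v‖ := by
  have h1 := integral_mul_norm_le_Lp_mul_Lq (Real.HolderConjugate.conjExponent hq).symm hk
    (Lp.memLp v)
  simp only [Real.norm_eq_abs] at h1
  rw [← norm_Lp_rpow_eq hq, ← Real.rpow_mul (norm_nonneg _), mul_one_div_cancel (by linarith),
    Real.rpow_one] at h1
  refine le_trans ?_ h1
  refine (abs_integral_le_integral_abs).trans (le_of_eq ?_)
  simp only [abs_mul]

/-- On a finite measure space the functional `w ↦ ∫ G (x, w x)`, with `G` the primitive of `g`, is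
Fréchet differentiable on `L^q`. The remainder tends to zero in the dual space because, along a
subsequence of increments `v` which tends to zero almost everywhere, the positive part of
`|R| ^ q' - D |v| ^ q` is dominated by a fixed integrable function, whereas `∫ |v| ^ q → 0`. -/
theorem GrowthFunction.exists_hasFDerivAt_integral_primitive [IsFiniteMeasure μ]
    [Fact (1 ≤ ENNReal.ofReal q)] (hg : GrowthFunction q a b g) (hq : 1 < q)
    (w : Lp ℝ (ENNReal.ofReal q) μ) :
    ∃ L : Lp ℝ (ENNReal.ofReal q) μ →L[ℝ] ℝ,
      HasFDerivAt (fun w : Lp ℝ (ENNReal.ofReal q) μ => ∫ x, primitive g x (w x) ∂μ) L w ∧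
      ∀ v, L v = ∫ x, g x (w x) * v x ∂μ := by
  have hc := Real.HolderConjugate.conjExponent hq
  set p := q.conjExponent with hp
  have hp0 : 0 < p := hc.symm.pos
  have hi : ∀ v : Lp ℝ (ENNReal.ofReal q) μ, Integrable (fun x => g x (w x) * v x) μ :=
    fun v => hg.integrable_comp_mul hq (Lp.memLp w) (Lp.memLp v)
  let L₀ : Lp ℝ (ENNReal.ofReal q) μ →ₗ[ℝ] ℝ :=
    { toFun := fun v => ∫ x, g x (w x) * v x ∂μ
      map_add' := fun v v' => by
        rw [← integral_add (hi v) (hi v')]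
        refine integral_congr_ae ?_
        filter_upwards [Lp.coeFn_add v v'] with x hx
        rw [hx, Pi.add_apply, mul_add]
      map_smul' := fun c v => by
        rw [RingHom.id_apply, smul_eq_mul, ← integral_const_mul]
        refine integral_congr_ae ?_
        filter_upwards [Lp.coeFn_smul c v] with x hx
        rw [hx, Pi.smul_apply, smul_eq_mul]; ring }
  refine ⟨L₀.mkContinuous _ fun v => abs_integral_mul_le hq (hg.memLp_comp hq (Lp.memLp w)) v,
    ?_, fun v => rfl⟩
  set R : Lp ℝ (ENNReal.ofReal q) μ → Rn n → ℝ := fun v x => primitiveRemainder g x (w x) (v x)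
  set D := (2 * (a + b * 2 ^ (q - 1))) ^ p with hD
  have hD0 : 0 ≤ D := Real.rpow_nonneg (mul_nonneg zero_le_two
    (add_nonneg hg.nonneg_left (mul_nonneg hg.nonneg_right (by positivity)))) _
  have habs : ∀ v : Lp ℝ (ENNReal.ofReal q) μ, Integrable (fun x => |v x| ^ q) μ := by
    intro v
    have := (Lp.memLp v).integrable_norm_rpow (by simpa using by linarith) ENNReal.ofReal_ne_top
    rwa [ENNReal.toReal_ofReal (by linarith)] at this
  have hRm : ∀ v, AEStronglyMeasurable (R v) μ := by
    intro v
    have e1 := hg.aestronglyMeasurable_primitive_comp ((Lp.aestronglyMeasurable w).add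
      (Lp.aestronglyMeasurable v))
    have e2 := hg.aestronglyMeasurable_primitive_comp (Lp.aestronglyMeasurable w)
    have e3 := (hg.aestronglyMeasurable_comp (Lp.aestronglyMeasurable w)).mul
      (Lp.aestronglyMeasurable v)
    exact (((e1.sub e2).sub e3).aemeasurable.div
      (Lp.aestronglyMeasurable v).aemeasurable).aestronglyMeasurable
  have hRle : ∀ v x, |R v x| ^ p ≤ D * (1 + |w x| ^ q + |v x| ^ q) := fun v x =>
    hg.abs_primitiveRemainder_rpow_le hq x (w x) (v x)
  have hRpm : ∀ v, AEStronglyMeasurable (fun x => |R v x| ^ p) μ := fun v =>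
    ((hRm v).aemeasurable.norm.pow_const p).aestronglyMeasurable
  have hRi : ∀ v, Integrable (fun x => |R v x| ^ p) μ := by
    intro v
    refine ((((integrable_const (1 : ℝ)).add (habs w)).add (habs v)).const_mul D).mono' (hRpm v)
      (Eventually.of_forall fun x => ?_)
    rw [Real.norm_of_nonneg (Real.rpow_nonneg (abs_nonneg _) _)]
    exact hRle v x
  have hRL : ∀ v, MemLp (R v) (ENNReal.ofReal p) μ := by
    intro v
    rw [← integrable_norm_rpow_iff (hRm v) (by simpa using hp0) ENNReal.ofReal_ne_top,
      ENNReal.toReal_ofReal hp0.le]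
    exact hRi v
  have hpos : ∀ v, Integrable (fun x => max (|R v x| ^ p - D * |v x| ^ q) 0) μ := fun v =>
    ((hRi v).sub ((habs v).const_mul D)).pos_part
  have hlim : Tendsto (fun v => ∫ x, |R v x| ^ p ∂μ) (𝓝 0) (𝓝 0) := by
    refine tendsto_of_subseq_tendsto fun v hv => ?_
    obtain ⟨ns, hns, hae⟩ := (tendstoInMeasure_of_tendsto_Lp hv).exists_seq_tendsto_ae'
    refine ⟨ns, ?_⟩
    have hmain : Tendsto (fun k => ∫ x, max (|R (v (ns k)) x| ^ p - D * |v (ns k) x| ^ q) 0 ∂μ)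
        atTop (𝓝 (∫ _, (0 : ℝ) ∂μ)) := by
      refine tendsto_integral_filter_of_dominated_convergence (fun x => D * (1 + |w x| ^ q))
        (Eventually.of_forall fun k => ?_) (Eventually.of_forall fun k => ?_)
        (((integrable_const (1 : ℝ)).add (habs w)).const_mul D) ?_
      · exact (hpos _).1
      · refine Eventually.of_forall fun x => ?_
        rw [Real.norm_of_nonneg (le_max_right _ _)]
        refine max_le (by linarith [hRle (v (ns k)) x]) (mul_nonneg hD0 ?_)
        linarith [Real.rpow_nonneg (abs_nonneg (w x)) q]
      · filter_upwards [hae, Lp.coeFn_zero ℝ (ENNReal.ofReal q) μ] with x hx hx0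
        rw [hx0, Pi.zero_apply] at hx
        have e1 : Tendsto (fun k => |R (v (ns k)) x| ^ p) atTop (𝓝 0) := by
          have := ((hg.tendsto_primitiveRemainder x (w x)).comp hx).abs.rpow_const
            (p := p) (Or.inr hp0.le)
          simpa [Real.zero_rpow hp0.ne'] using this
        refine squeeze_zero (fun k => le_max_right _ _) (fun k => max_le ?_ ?_) e1
        · linarith [mul_nonneg hD0 (Real.rpow_nonneg (abs_nonneg (v (ns k) x)) q)]
        · exact Real.rpow_nonneg (abs_nonneg _) _
    have hnorm : Tendsto (fun k => D * ‖v (ns k)‖ ^ q) atTop (𝓝 0) := by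
      have e1 : Tendsto (fun k => ‖v (ns k)‖) atTop (𝓝 0) :=
        tendsto_zero_iff_norm_tendsto_zero.1 (hv.comp hns)
      have := (e1.rpow_const (p := q) (Or.inr (by linarith))).const_mul D
      simpa [Real.zero_rpow (show q ≠ 0 by linarith)] using this
    have hsum := hmain.add hnorm
    rw [integral_zero, add_zero] at hsum
    refine squeeze_zero (fun k => integral_nonneg fun x => Real.rpow_nonneg (abs_nonneg _) _)
      (fun k => ?_) hsum
    rw [norm_Lp_rpow_eq hq, ← integral_const_mul, ← integral_add
      (hpos _) ((habs _).const_mul D)]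
    refine integral_mono (hRi _) ((hpos _).add ((habs _).const_mul D)) fun x => ?_
    have := le_max_left (|R (v (ns k)) x| ^ p - D * |v (ns k) x| ^ q) 0
    simp only
    linarith
  have hlim' : Tendsto (fun v => (∫ x, |R v x| ^ p ∂μ) ^ (1 / p)) (𝓝 0) (𝓝 0) := by
    have := hlim.rpow_const (p := 1 / p) (Or.inr (by positivity))
    rwa [Real.zero_rpow (by positivity)] at this
  rw [hasFDerivAt_iff_isLittleO_nhds_zero]
  have key : ∀ v : Lp ℝ (ENNReal.ofReal q) μ,
      |(∫ x, primitive g x ((w + v : Lp ℝ (ENNReal.ofReal q) μ) x) ∂μ)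
        - (∫ x, primitive g x (w x) ∂μ) - ∫ x, g x (w x) * v x ∂μ| ≤
      (∫ x, |R v x| ^ p ∂μ) ^ (1 / p) * ‖v‖ := by
    intro v
    refine le_trans (le_of_eq ?_) (abs_integral_mul_le hq (hRL v) v)
    congr 1
    have e1 := hg.integrable_primitive_comp hq (Lp.memLp (w + v))
    have e2 := hg.integrable_primitive_comp hq (Lp.memLp w)
    have e3 : Integrable (fun x => primitive g x ((w + v : Lp ℝ (ENNReal.ofReal q) μ) x)
      - primitive g x (w x)) μ := e1.sub e2
    rw [← integral_sub e1 e2, ← integral_sub e3 (hi v)]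
    refine integral_congr_ae ?_
    filter_upwards [Lp.coeFn_add w v] with x hx
    rw [hx, Pi.add_apply]
    exact (primitiveRemainder_mul g x (w x) (v x)).symm
  rw [Asymptotics.isLittleO_iff]
  intro c hc0
  filter_upwards [hlim'.eventually (gt_mem_nhds hc0)] with v hv
  refine (key v).trans ?_
  exact mul_le_mul_of_nonneg_right hv.le (norm_nonneg _)

end Superposition

/-! ### The local energy and averages over balls -/

section Averages

variable {n : ℕ}

/-- The volume of the unit ball of `ℝⁿ`. -/
noncomputable def unitBallVolume (n : ℕ) : ℝ := volume.real (Metric.ball (0 : Rn n) 1)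

lemma unitBallVolume_pos : 0 < unitBallVolume n :=
  ENNReal.toReal_pos (Metric.measure_ball_pos _ _ one_pos).ne' measure_ball_lt_top.ne

lemma volume_real_ball (x : Rn n) {ρ : ℝ} (hρ : 0 < ρ) :
    volume.real (Metric.ball x ρ) = ρ ^ n * unitBallVolume n := by
  rw [Measure.real, Measure.addHaar_ball_of_pos _ _ hρ, ENNReal.toReal_mul,
    ENNReal.toReal_ofReal (by positivity), finrank_euclideanSpace_fin]
  rfl

lemma volume_real_ball_pos (x : Rn n) {ρ : ℝ} (hρ : 0 < ρ) :
    0 < volume.real (Metric.ball x ρ) := by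
  rw [volume_real_ball x hρ]
  exact mul_pos (pow_pos hρ n) unitBallVolume_pos

/-- Jensen's inequality for the average over a ball, whose volume is `ρ ^ n` times that of the unit
ball. -/
lemma abs_setAverage_rpow_le {p : ℝ} (hp : 1 ≤ p) {v : Rn n → ℝ}
    (hvp : Integrable (fun y => |v y| ^ p)) (x : Rn n) {ρ : ℝ} (hρ : 0 < ρ)
    (hv : IntegrableOn v (Metric.ball x ρ)) :
    |⨍ y in Metric.ball x ρ, v y| ^ p ≤ (ρ ^ n * unitBallVolume n)⁻¹ * ∫ y, |v y| ^ p := by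
  have hB := volume_real_ball_pos x hρ
  have hne : volume (Metric.ball x ρ) ≠ 0 := (Metric.measure_ball_pos _ _ hρ).ne'
  have hfin : volume (Metric.ball x ρ) ≠ ⊤ := measure_ball_lt_top.ne
  have h1 : |⨍ y in Metric.ball x ρ, v y| ≤ ⨍ y in Metric.ball x ρ, |v y| := by
    rw [setAverage_eq, setAverage_eq, smul_eq_mul, smul_eq_mul, abs_mul,
      abs_of_nonneg (inv_nonneg.2 hB.le)]
    exact mul_le_mul_of_nonneg_left abs_integral_le_integral_abs (inv_nonneg.2 hB.le)
  have h2 := (convexOn_rpow hp).map_set_average_le (μ := volume) (t := Metric.ball x ρ)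
    (f := fun y => |v y|)
    (continuousOn_id.rpow_const fun y _ => Or.inr (by linarith)) isClosed_Ici hne hfin
    (Eventually.of_forall fun y => abs_nonneg (v y)) hv.abs hvp.integrableOn
  refine (Real.rpow_le_rpow (abs_nonneg _) h1 (by linarith)).trans (h2.trans ?_)
  rw [setAverage_eq, smul_eq_mul, volume_real_ball x hρ]
  refine mul_le_mul_of_nonneg_left ?_ (inv_nonneg.2 ?_)
  · exact setIntegral_le_integral hvp
      (Eventually.of_forall fun y => Real.rpow_nonneg (abs_nonneg _) _)
  · exact (mul_pos (pow_pos hρ n) unitBallVolume_pos).le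

lemma stronglyMeasurable_setAverage_ball {v : Rn n → ℝ} (hv : AEStronglyMeasurable v volume)
    {ρ : ℝ} (hρ : 0 < ρ) :
    StronglyMeasurable fun x : Rn n => ⨍ y in Metric.ball x ρ, v y := by
  have hS : MeasurableSet {p : Rn n × Rn n | dist p.2 p.1 < ρ} :=
    (isOpen_lt (by fun_prop) continuous_const).measurableSet
  have h1 : StronglyMeasurable fun x : Rn n =>
      ∫ y, {p : Rn n × Rn n | dist p.2 p.1 < ρ}.indicator (fun p => hv.mk v p.2) (x, y) :=
    ((hv.stronglyMeasurable_mk.comp_measurable measurable_snd).indicator hS).integral_prod_right'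
  have h2 : (fun x : Rn n => ⨍ y in Metric.ball x ρ, v y) = fun x =>
      (ρ ^ n * unitBallVolume n)⁻¹ *
        ∫ y, {p : Rn n × Rn n | dist p.2 p.1 < ρ}.indicator (fun p => hv.mk v p.2) (x, y) := by
    funext x
    rw [setAverage_eq, volume_real_ball x hρ, smul_eq_mul,
      setIntegral_congr_ae₀ (g := hv.mk v) measurableSet_ball.nullMeasurableSet
        (hv.ae_eq_mk.mono fun y hy _ => hy), ← integral_indicator measurableSet_ball]
    rfl
  rw [h2]
  exact h1.const_mul _

end Averages

section LocalEnergy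

variable {n : ℕ} {s : ℝ} {Ω : Set (Rn n)} {K : Rn n → ℝ} {h : Standing n s Ω K}

lemma Standing.natCast_pos (h : Standing n s Ω K) : (0 : ℝ) < n := by
  linarith [h.s_pos, h.two_s_lt]

lemma Standing.isFiniteMeasure (h : Standing n s Ω K) : IsFiniteMeasure (volume.restrict Ω) :=
  ⟨by simpa using h.isBounded.measure_lt_top⟩

/-- The contribution of the point `x` to the energy,
`∫ |u x - u y|² K (x - y) dy`. -/
noncomputable def localEnergy (K : Rn n → ℝ) (u : Rn n → ℝ) (x : Rn n) : ℝ :=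
  ∫ y, weightedDiff K u (x, y) ^ 2

lemma localEnergy_nonneg (u : Rn n → ℝ) (x : Rn n) : 0 ≤ localEnergy K u x :=
  integral_nonneg fun _ => sq_nonneg _

namespace X0

lemma memLp_of_restrict {p : ENNReal} (u : X0 h) (hu : MemLp u p (volume.restrict Ω)) :
    MemLp u p volume := by
  rw [← memLp_indicator_iff_restrict h.isOpen.measurableSet] at hu
  refine (memLp_congr_ae ?_).1 hu
  filter_upwards [ae_zero u] with x hx
  by_cases hxΩ : x ∈ Ω
  · rw [indicator_of_mem hxΩ]
  · rw [indicator_of_notMem hxΩ, hx hxΩ]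

lemma memLp_two (u : X0 h) : MemLp u 2 volume := memLp_of_restrict u u.2.1

lemma integrable_weightedDiff_sq (u : X0 h) :
    Integrable (fun p => weightedDiff K u p ^ 2) volume :=
  (memLp_weightedDiff u).integrable_sq

lemma norm_sq_eq_integral (u : X0 h) : ‖u‖ ^ 2 = ∫ p, weightedDiff K u p ^ 2 := by
  rw [← real_inner_self_eq_norm_sq, inner_def, energyForm_eq h]
  simp only [sq]

lemma integrable_localEnergy (u : X0 h) : Integrable (localEnergy K u) :=
  Integrable.integral_prod_left (μ := volume) (ν := volume) (integrable_weightedDiff_sq u)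

lemma integral_localEnergy (u : X0 h) : ∫ x, localEnergy K u x = ‖u‖ ^ 2 := by
  rw [norm_sq_eq_integral]
  exact (integral_prod (μ := volume) (ν := volume) _ (integrable_weightedDiff_sq u)).symm

/-- The oscillation of `u`, or of a truncation `ψ ∘ u`, around its average over the ball of
radius `ρ` is controlled by the local energy, because `|x - y| < ρ` bounds the kernel from below
by `θ ρ ^ (-(n + 2 s))`. -/
lemma sq_sub_setAverage_le {θ : ℝ} (hθ : 0 < θ)
    (hK : ∀ x, x ≠ 0 → θ * ‖x‖ ^ (-((n : ℝ) + 2 * s)) ≤ K x) (u : X0 h) {ψ : ℝ → ℝ}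
    (hψ : LipschitzWith 1 ψ) (hψ0 : ψ 0 = 0) :
    ∀ᵐ x, ∀ ρ : ℝ, 0 < ρ → (ψ (u x) - ⨍ y in Metric.ball x ρ, ψ (u y)) ^ 2 ≤
      (θ * unitBallVolume n)⁻¹ * ρ ^ (2 * s) * localEnergy K u x := by
  have hs := h.s_pos
  have hint : ∀ᵐ x : Rn n, Integrable fun y => weightedDiff K u (x, y) ^ 2 :=
    Integrable.prod_right_ae (μ := volume) (ν := volume) (integrable_weightedDiff_sq u)
  have hv : MemLp (ψ ∘ u) 2 volume := hψ.comp_memLp hψ0 (memLp_two u)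
  filter_upwards [hint] with x hx ρ hρ
  have hB := volume_real_ball_pos x hρ
  have hne : volume (Metric.ball x ρ) ≠ 0 := (Metric.measure_ball_pos _ _ hρ).ne'
  have hfin : volume (Metric.ball x ρ) ≠ ⊤ := measure_ball_lt_top.ne
  have : IsFiniteMeasure (volume.restrict (Metric.ball x ρ)) := ⟨by simpa using hfin.lt_top⟩
  have hd : MemLp (fun y => ψ (u x) - ψ (u y)) 2 (volume.restrict (Metric.ball x ρ)) :=
    (memLp_const _).sub (hv.restrict _)
  have hd1 : IntegrableOn (fun y => ψ (u x) - ψ (u y)) (Metric.ball x ρ) :=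
    hd.integrable (by norm_num)
  have hd2 : IntegrableOn (fun y => (ψ (u x) - ψ (u y)) ^ 2) (Metric.ball x ρ) := hd.integrable_sq
  have hvi : IntegrableOn (fun y => ψ (u y)) (Metric.ball x ρ) :=
    (hv.restrict (Metric.ball x ρ)).integrable (by norm_num)
  have e1 : ψ (u x) - ⨍ y in Metric.ball x ρ, ψ (u y) =
      ⨍ y in Metric.ball x ρ, (ψ (u x) - ψ (u y)) := by
    rw [setAverage_eq, setAverage_eq, integral_sub (integrable_const _) hvi, setIntegral_const,
      smul_sub, smul_smul, inv_mul_cancel₀ hB.ne', one_smul]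
  have e2 := (even_two.convexOn_pow (𝕜 := ℝ)).map_set_average_le (μ := volume)
    (t := Metric.ball x ρ) (f := fun y => ψ (u x) - ψ (u y)) (continuous_pow 2).continuousOn
    isClosed_univ hne hfin (by simp) hd1 hd2
  rw [e1]
  refine e2.trans ?_
  have e3 : ∀ y ∈ Metric.ball x ρ,
      (ψ (u x) - ψ (u y)) ^ 2 ≤ θ⁻¹ * ρ ^ ((n : ℝ) + 2 * s) * weightedDiff K u (x, y) ^ 2 := by
    intro y hy
    by_cases hxy : x = y
    · subst hxy; simp [weightedDiff]
    have hsub : x - y ≠ 0 := sub_ne_zero.2 hxy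
    have hn0 : 0 < ‖x - y‖ := norm_pos_iff.2 hsub
    have hlt : ‖x - y‖ ≤ ρ := by
      rw [← dist_eq_norm, dist_comm]; exact (Metric.mem_ball.1 hy).le
    have hl : |ψ (u x) - ψ (u y)| ≤ |u x - u y| := by
      have := hψ.dist_le_mul (u x) (u y)
      simpa [Real.dist_eq] using this
    have hl2 := sq_le_sq.2 hl
    have hKx : θ * ρ ^ (-((n : ℝ) + 2 * s)) ≤ K (x - y) := by
      refine le_trans (mul_le_mul_of_nonneg_left ?_ hθ.le) (hK _ hsub)
      refine Real.rpow_le_rpow_of_nonpos hn0 hlt ?_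
      have := h.natCast_pos
      linarith
    rw [Real.rpow_neg hρ.le] at hKx
    have hR : 0 < ρ ^ ((n : ℝ) + 2 * s) := Real.rpow_pos_of_pos hρ _
    have e4 : weightedDiff K u (x, y) ^ 2 = (u x - u y) ^ 2 * K (x - y) := by
      rw [weightedDiff, mul_pow, Real.sq_sqrt (h.kernel_pos _ hsub).le]
    rw [e4]
    have e5 : 1 ≤ θ⁻¹ * ρ ^ ((n : ℝ) + 2 * s) * K (x - y) := by
      calc (1 : ℝ) = θ⁻¹ * ρ ^ ((n : ℝ) + 2 * s) * (θ * (ρ ^ ((n : ℝ) + 2 * s))⁻¹) := by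
            field_simp
        _ ≤ _ := mul_le_mul_of_nonneg_left hKx (by positivity)
    nlinarith [sq_nonneg (u x - u y)]
  have e6 : ∫ y in Metric.ball x ρ, (ψ (u x) - ψ (u y)) ^ 2 ≤
      θ⁻¹ * ρ ^ ((n : ℝ) + 2 * s) * localEnergy K u x := by
    rw [localEnergy, ← integral_const_mul]
    refine (setIntegral_mono_on hd2 (hx.const_mul _).integrableOn measurableSet_ball e3).trans ?_
    refine setIntegral_le_integral (hx.const_mul _) (Eventually.of_forall fun y => ?_)
    exact mul_nonneg (mul_nonneg (inv_nonneg.2 hθ.le) (Real.rpow_nonneg hρ.le _)) (sq_nonneg _)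
  rw [setAverage_eq, smul_eq_mul]
  refine (mul_le_mul_of_nonneg_left e6 (inv_nonneg.2 hB.le)).trans (le_of_eq ?_)
  rw [volume_real_ball x hρ, Real.rpow_add hρ, Real.rpow_natCast]
  have := unitBallVolume_pos (n := n)
  field_simp

end X0
end LocalEnergy

/-! ### The Sobolev inequality -/

section Sobolev

variable {n : ℕ} {s : ℝ} {Ω : Set (Rn n)} {K : Rn n → ℝ} {h : Standing n s Ω K}

/-- The fractional critical exponent `2* = 2 n / (n - 2 s)`. -/
noncomputable def criticalExponent (n : ℕ) (s : ℝ) : ℝ := 2 * n / (n - 2 * s)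

lemma Standing.two_lt_criticalExponent (h : Standing n s Ω K) : 2 < criticalExponent n s := by
  have := h.s_pos
  rw [criticalExponent, lt_div_iff₀ (by linarith [h.two_s_lt])]
  linarith

lemma Standing.two_div_criticalExponent (h : Standing n s Ω K) :
    2 / criticalExponent n s = 1 - 2 * s / n := by
  have := h.natCast_pos
  have : (n : ℝ) - 2 * s ≠ 0 := by linarith [h.two_s_lt]
  rw [criticalExponent]
  field_simp

namespace X0

/-- The Sobolev inequality for bounded truncations. At a point where `t = |ψ (u x)|` does not
vanish, the radius is chosen so that the average over the ball is at most `t / 2`; the oscillation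
estimate then bounds `t ^ 2*` by the local energy times a power of `∫ |ψ ∘ u| ^ 2*`, and that
power is less than `1`, so that it can be absorbed. -/
lemma exists_eLpNorm_comp_le (h : Standing n s Ω K) :
    ∃ C : ℝ, 0 ≤ C ∧ ∀ (u : X0 h) (ψ : ℝ → ℝ) (M : ℝ), LipschitzWith 1 ψ → ψ 0 = 0 →
      (∀ t, |ψ t| ≤ M) →
      eLpNorm (ψ ∘ u) (ENNReal.ofReal (criticalExponent n s)) volume ≤
        ENNReal.ofReal (C * ‖u‖) := by
  obtain ⟨θ, hθ, hK⟩ := h.kernel_lower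
  have hω := unitBallVolume_pos (n := n)
  have hn := h.natCast_pos
  have hn0 : n ≠ 0 := by rintro rfl; simp at hn
  have hs := h.s_pos
  have hp2 := h.two_lt_criticalExponent
  have hps := h.two_div_criticalExponent
  set p := criticalExponent n s with hp
  have hp0 : 0 < p := by linarith
  set ω := unitBallVolume n
  set σ : ℝ := 2 * s / n with hσ
  have hσ0 : 0 < σ := by positivity
  have hpσ : 2 + p * σ = p := by
    have : σ = 1 - 2 / p := by linarith
    rw [this]; field_simp; ring
  set A : ℝ := (θ * ω)⁻¹ with hA
  have hA0 : 0 < A := by positivity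
  set C₁ : ℝ := 2 ^ p * A * (ω ^ σ)⁻¹ with hC₁
  have hC₁0 : 0 < C₁ := by positivity
  refine ⟨√C₁, Real.sqrt_nonneg _, fun u ψ M hψ hψ0 hM => ?_⟩
  have hv : MemLp (ψ ∘ u) 2 volume := hψ.comp_memLp hψ0 (memLp_two u)
  have hfin := h.isFiniteMeasure
  have hvp : MemLp (ψ ∘ u) (ENNReal.ofReal p) volume := by
    have h1 : MemLp (ψ ∘ u) (ENNReal.ofReal p) (volume.restrict Ω) :=
      MemLp.of_bound (hv.1.restrict) M (Eventually.of_forall fun x => hM _)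
    rw [← memLp_indicator_iff_restrict h.isOpen.measurableSet] at h1
    refine (memLp_congr_ae ?_).1 h1
    filter_upwards [ae_zero u] with x hx
    by_cases hxΩ : x ∈ Ω
    · rw [indicator_of_mem hxΩ]
    · rw [indicator_of_notMem hxΩ, Function.comp_apply, hx hxΩ, hψ0]
  have hI : Integrable (fun x => |ψ (u x)| ^ p) := by
    have := hvp.integrable_norm_rpow (by simpa using hp0) ENNReal.ofReal_ne_top
    rwa [ENNReal.toReal_ofReal hp0.le] at this
  set I : ℝ := ∫ x, |ψ (u x)| ^ p with hIdef
  have hI0 : 0 ≤ I := integral_nonneg fun x => Real.rpow_nonneg (abs_nonneg _) _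
  have hnorm : eLpNorm (ψ ∘ u) (ENNReal.ofReal p) volume = ENNReal.ofReal (I ^ p⁻¹) := by
    rw [hvp.eLpNorm_eq_integral_rpow_norm (by simpa using hp0) ENNReal.ofReal_ne_top,
      ENNReal.toReal_ofReal hp0.le]
    rfl
  rw [hnorm]
  refine ENNReal.ofReal_le_ofReal ?_
  rcases hI0.eq_or_lt with hI00 | hIpos
  · rw [← hI00, Real.zero_rpow (by positivity)]; positivity
  have hpt : ∀ᵐ x, |ψ (u x)| ^ p ≤ C₁ * I ^ σ * localEnergy K u x := by
    filter_upwards [sq_sub_setAverage_le hθ hK u hψ hψ0] with x hx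
    have hE := localEnergy_nonneg (K := K) u x
    rcases (abs_nonneg (ψ (u x))).eq_or_lt with ht0 | ht
    · rw [← ht0, Real.zero_rpow hp0.ne']; positivity
    set t : ℝ := |ψ (u x)| with htdef
    have ht2 : 0 < t / 2 := by positivity
    have htp : 0 < (t / 2) ^ p := by positivity
    -- With this radius, Jensen's inequality bounds the average over the ball by exactly `t / 2`.
    set ρ : ℝ := (I / (ω * (t / 2) ^ p)) ^ ((n : ℝ)⁻¹) with hρdef
    have hρ : 0 < ρ := by positivity
    have hρn : ρ ^ n = I / (ω * (t / 2) ^ p) := Real.rpow_inv_natCast_pow (by positivity) hn0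
    have hρs : ρ ^ (2 * s) = I ^ σ * (ω ^ σ)⁻¹ * ((t / 2) ^ (p * σ))⁻¹ := by
      rw [hρdef, ← Real.rpow_mul (by positivity), show (n : ℝ)⁻¹ * (2 * s) = σ by
        rw [hσ]; ring, Real.div_rpow hI0 (by positivity), Real.mul_rpow hω.le htp.le,
        ← Real.rpow_mul ht2.le, div_eq_mul_inv, mul_inv, mul_assoc]
    have hav := abs_setAverage_rpow_le (p := p) (by linarith) hI x hρ
      ((hv.locallyIntegrable (by norm_num)).integrableOn_isCompact
        (isCompact_closedBall x ρ) |>.mono_set Metric.ball_subset_closedBall)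
    have hav' : |⨍ y in Metric.ball x ρ, ψ (u y)| ≤ t / 2 := by
      rw [← Real.rpow_le_rpow_iff (abs_nonneg _) ht2.le hp0]
      refine hav.trans (le_of_eq ?_)
      rw [hρn]
      change (I / (ω * (t / 2) ^ p) * ω)⁻¹ * I = _
      field_simp
    have h1 : (t / 2) ^ 2 ≤ A * ρ ^ (2 * s) * localEnergy K u x := by
      refine le_trans ?_ (hx ρ hρ)
      rw [← sq_abs (ψ (u x) - _)]
      refine pow_le_pow_left₀ ht2.le ?_ 2
      have := abs_sub_abs_le_abs_sub (ψ (u x)) (⨍ y in Metric.ball x ρ, ψ (u y))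
      linarith
    have h2 : (t / 2) ^ p = (t / 2) ^ 2 * (t / 2) ^ (p * σ) := by
      rw [← Real.rpow_natCast (t / 2) 2, ← Real.rpow_add ht2]
      congr 1
      push_cast
      linarith
    have htσ : 0 < (t / 2) ^ (p * σ) := by positivity
    have h3 : (t / 2) ^ p ≤ A * (I ^ σ * (ω ^ σ)⁻¹) * localEnergy K u x := by
      rw [h2]
      refine (mul_le_mul_of_nonneg_right h1 htσ.le).trans (le_of_eq ?_)
      rw [hρs]
      field_simp
    rw [Real.div_rpow ht.le (by norm_num), div_le_iff₀ (by positivity)] at h3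
    refine h3.trans (le_of_eq ?_)
    rw [hC₁]; ring
  have h4 : I ≤ C₁ * I ^ σ * ‖u‖ ^ 2 := by
    rw [← integral_localEnergy u, ← integral_const_mul]
    exact integral_mono_ae hI ((integrable_localEnergy u).const_mul _) hpt
  have h5 : I ^ (2 / p) ≤ C₁ * ‖u‖ ^ 2 := by
    rw [hps, Real.rpow_sub hIpos, Real.rpow_one, div_le_iff₀ (by positivity)]
    linarith
  have h6 : I ^ p⁻¹ = √(I ^ (2 / p)) := by
    rw [Real.sqrt_eq_rpow, ← Real.rpow_mul hI0]
    congr 1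
    field_simp
  calc I ^ p⁻¹ = √(I ^ (2 / p)) := h6
    _ ≤ √(C₁ * ‖u‖ ^ 2) := Real.sqrt_le_sqrt h5
    _ = √C₁ * ‖u‖ := by rw [Real.sqrt_mul hC₁0.le, Real.sqrt_sq (norm_nonneg u)]

/-- The Sobolev inequality `‖u‖_{L^{2*}} ≤ C ‖u‖` on `X₀`. -/
theorem exists_eLpNorm_criticalExponent_le (h : Standing n s Ω K) :
    ∃ C : ℝ, 0 ≤ C ∧ ∀ u : X0 h,
      eLpNorm u (ENNReal.ofReal (criticalExponent n s)) volume ≤ ENNReal.ofReal (C * ‖u‖) := by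
  obtain ⟨C, hC, hle⟩ := exists_eLpNorm_comp_le h
  refine ⟨C, hC, fun u => ?_⟩
  -- Truncations at height `k` converge pointwise to `u`; Fatou's lemma passes to the limit.
  let ψ : ℕ → ℝ → ℝ := fun k t => max (-(k : ℝ)) (min (k : ℝ) t)
  have hψ : ∀ k, LipschitzWith 1 (ψ k) := fun k =>
    (LipschitzWith.id.const_min _).const_max _
  have hψM : ∀ k t, |ψ k t| ≤ k := fun k t => by
    have hk : (0 : ℝ) ≤ k := Nat.cast_nonneg k
    exact abs_le.2 ⟨le_max_left _ _, max_le (by linarith) (min_le_left _ _)⟩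
  have hψ0 : ∀ k, ψ k 0 = 0 := fun k => by simp [ψ]
  refine (Lp.eLpNorm_lim_le_liminf_eLpNorm (f := fun k => ψ k ∘ u) (fun k => ?_) u
    (Eventually.of_forall fun x => ?_)).trans ?_
  · exact (hψ k).continuous.comp_aestronglyMeasurable (memLp_two u).1
  · refine tendsto_const_nhds.congr' ?_
    filter_upwards [eventually_ge_atTop ⌈|u x|⌉₊] with k hk
    have hk' : |u x| ≤ k := Nat.ceil_le.1 hk
    rw [abs_le] at hk'
    simp [ψ, hk'.1, hk'.2]
  · refine liminf_le_of_le (by isBoundedDefault) fun b hb => ?_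
    obtain ⟨k, hk⟩ := hb.exists
    exact hk.trans (hle u (ψ k) k (hψ k) (hψ0 k) (hψM k))

/-- On the bounded set `Ω` the Sobolev inequality holds for every exponent up to the critical
one. -/
lemma exists_eLpNorm_le (h : Standing n s Ω K) {r : ℝ} (hr : 0 < r)
    (hrp : r ≤ criticalExponent n s) :
    ∃ C : ℝ, 0 ≤ C ∧ ∀ u : X0 h,
      eLpNorm u (ENNReal.ofReal r) (volume.restrict Ω) ≤ ENNReal.ofReal (C * ‖u‖) := by
  obtain ⟨C, hC, hle⟩ := exists_eLpNorm_criticalExponent_le h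
  have hfin := h.isFiniteMeasure
  set e : ℝ := 1 / r - 1 / criticalExponent n s with he
  have he0 : 0 ≤ e := sub_nonneg.2 (one_div_le_one_div_of_le hr hrp)
  have hV : (volume.restrict Ω) univ ^ e ≠ ⊤ :=
    ENNReal.rpow_ne_top_of_nonneg he0 (measure_ne_top _ _)
  refine ⟨C * ((volume.restrict Ω) univ ^ e).toReal, by positivity, fun u => ?_⟩
  refine (eLpNorm_le_eLpNorm_mul_rpow_measure_univ (ENNReal.ofReal_le_ofReal hrp)
    (memLp_two u).1.restrict).trans ?_
  rw [ENNReal.toReal_ofReal hr.le, ENNReal.toReal_ofReal (hr.le.trans hrp), ← he,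
    mul_right_comm, ENNReal.ofReal_mul (by positivity), ENNReal.ofReal_toReal hV]
  gcongr
  exact (eLpNorm_mono_measure _ Measure.restrict_le_self).trans (hle u)

lemma memLp_of_le_criticalExponent {r : ℝ} (hr : 0 < r) (hrp : r ≤ criticalExponent n s)
    (u : X0 h) : MemLp u (ENNReal.ofReal r) (volume.restrict Ω) := by
  obtain ⟨C, -, hle⟩ := exists_eLpNorm_le h hr hrp
  exact ⟨(memLp_two u).1.restrict, (hle u).trans_lt ENNReal.ofReal_lt_top⟩

/-- The restriction to `Ω`, as a linear map of `X₀` to `L^r(Ω)`. -/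
noncomputable def toLpLinear (h : Standing n s Ω K) {r : ℝ} (hr : 0 < r)
    (hrp : r ≤ criticalExponent n s) :
    X0 h →ₗ[ℝ] Lp ℝ (ENNReal.ofReal r) (volume.restrict Ω) where
  toFun u := (memLp_of_le_criticalExponent hr hrp u).toLp u
  map_add' u v := by
    rw [← MemLp.toLp_add]
    exact MemLp.toLp_congr _ _ (ae_restrict_of_ae (coe_add u v))
  map_smul' c u := by
    rw [RingHom.id_apply, ← MemLp.toLp_const_smul]
    exact MemLp.toLp_congr _ _ (ae_restrict_of_ae (coe_smul c u))

lemma coeFn_toLpLinear {r : ℝ} (hr : 0 < r) (hrp : r ≤ criticalExponent n s) (u : X0 h) :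
    toLpLinear h hr hrp u =ᵐ[volume.restrict Ω] u :=
  MemLp.coeFn_toLp (memLp_of_le_criticalExponent hr hrp u)

lemma exists_norm_toLpLinear_le (h : Standing n s Ω K) {r : ℝ} (hr : 0 < r)
    (hrp : r ≤ criticalExponent n s) : ∃ C : ℝ, 0 ≤ C ∧ ∀ u : X0 h,
      ‖toLpLinear h hr hrp u‖ ≤ C * ‖u‖ := by
  obtain ⟨C, hC, hle⟩ := exists_eLpNorm_le h hr hrp
  refine ⟨C, hC, fun u => ?_⟩
  change ‖(memLp_of_le_criticalExponent hr hrp u).toLp u‖ ≤ _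
  rw [Lp.norm_toLp]
  exact ENNReal.toReal_le_of_le_ofReal (by positivity) (hle u)

end X0
end Sobolev

/-! ### `X₀` as a Hilbert space -/

section Completeness

variable {n : ℕ} {s : ℝ} {Ω : Set (Rn n)} {K : Rn n → ℝ} {h : Standing n s Ω K}

namespace X0

lemma integral_rpow_eq_norm_toLpLinear {r : ℝ} (hr : 1 < r) (hrp : r ≤ criticalExponent n s)
    (u : X0 h) :
    ∫ x in Ω, |u x| ^ r = ‖toLpLinear h (zero_lt_one.trans hr) hrp u‖ ^ r := by
  have : Fact (1 ≤ ENNReal.ofReal r) := ⟨by simpa using hr.le⟩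
  rw [norm_Lp_rpow_eq hr]
  refine integral_congr_ae ?_
  filter_upwards [coeFn_toLpLinear (zero_lt_one.trans hr) hrp u] with x hx
  rw [hx]

lemma exists_integral_rpow_le (h : Standing n s Ω K) {r : ℝ} (hr : 1 < r)
    (hrp : r ≤ criticalExponent n s) :
    ∃ C : ℝ, 0 ≤ C ∧ ∀ u : X0 h, ∫ x in Ω, |u x| ^ r ≤ (C * ‖u‖) ^ r := by
  obtain ⟨C, hC, hle⟩ := exists_norm_toLpLinear_le h (zero_lt_one.trans hr) hrp
  refine ⟨C, hC, fun u => ?_⟩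
  have : Fact (1 ≤ ENNReal.ofReal r) := ⟨by simpa using hr.le⟩
  rw [integral_rpow_eq_norm_toLpLinear hr hrp]
  exact Real.rpow_le_rpow (norm_nonneg _) (hle u) (by linarith)

lemma integrableOn_rpow {r : ℝ} (hr : 0 < r) (hrp : r ≤ criticalExponent n s) (u : X0 h) :
    IntegrableOn (fun x => |u x| ^ r) Ω := by
  have := (memLp_of_le_criticalExponent hr hrp u).integrable_norm_rpow (by simpa using hr)
    ENNReal.ofReal_ne_top
  rwa [ENNReal.toReal_ofReal hr.le] at this

lemma setIntegral_sq_eq (u : X0 h) : ∫ x in Ω, u x ^ 2 = ∫ x, u x ^ 2 := by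
  refine setIntegral_eq_integral_of_ae_compl_eq_zero ?_
  filter_upwards [ae_zero u] with x hx hxΩ
  rw [hx hxΩ]; norm_num

/-- The Poincaré inequality. -/
lemma exists_integral_sq_le (h : Standing n s Ω K) :
    ∃ C : ℝ, 0 ≤ C ∧ ∀ u : X0 h, ∫ x, u x ^ 2 ≤ (C * ‖u‖) ^ 2 := by
  obtain ⟨C, hC, hle⟩ := exists_integral_rpow_le h (r := 2) one_lt_two
    h.two_lt_criticalExponent.le
  refine ⟨C, hC, fun u => ?_⟩
  have := hle u
  simp only [Real.rpow_two, sq_abs] at this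
  rwa [setIntegral_sq_eq] at this

/-- The inclusion of `X₀` in `L²(ℝⁿ)`. -/
noncomputable def toL2 (h : Standing n s Ω K) : X0 h →ₗ[ℝ] Lp ℝ 2 (volume : Measure (Rn n)) where
  toFun u := (memLp_two u).toLp u
  map_add' u v := by
    rw [← MemLp.toLp_add]
    exact MemLp.toLp_congr _ _ (coe_add u v)
  map_smul' c u := by
    rw [RingHom.id_apply, ← MemLp.toLp_const_smul]
    exact MemLp.toLp_congr _ _ (coe_smul c u)

lemma coeFn_toL2 (u : X0 h) : toL2 h u =ᵐ[volume] u := MemLp.coeFn_toLp (memLp_two u)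

lemma norm_sq_L2 {α : Type*} [MeasurableSpace α] {μ : Measure α} (f : Lp ℝ 2 μ) :
    ‖f‖ ^ 2 = ∫ x, f x ^ 2 ∂μ := by
  rw [← real_inner_self_eq_norm_sq, L2.inner_def]
  refine integral_congr_ae (Eventually.of_forall fun x => ?_)
  simp [sq]

lemma exists_norm_toL2_le (h : Standing n s Ω K) :
    ∃ C : ℝ, 0 ≤ C ∧ ∀ u : X0 h, ‖toL2 h u‖ ≤ C * ‖u‖ := by
  obtain ⟨C, hC, hle⟩ := exists_integral_sq_le h
  refine ⟨C, hC, fun u => ?_⟩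
  rw [← sq_le_sq₀ (norm_nonneg _) (by positivity), norm_sq_L2]
  refine le_trans (le_of_eq (integral_congr_ae ?_)) (hle u)
  filter_upwards [coeFn_toL2 u] with x hx
  rw [hx]

/-- The isometry of `X₀` into `L²(ℝⁿ × ℝⁿ)` given by the weighted difference. -/
noncomputable def weightedDiffL2 (h : Standing n s Ω K) :
    X0 h →ₗᵢ[ℝ] Lp ℝ 2 (volume : Measure (Rn n × Rn n)) where
  toFun u := (memLp_weightedDiff u).toLp (weightedDiff K u)
  map_add' u v := by
    rw [← MemLp.toLp_add]
    refine MemLp.toLp_congr _ _ ?_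
    rw [← weightedDiff_add]
    exact weightedDiff_congr (coe_add u v)
  map_smul' c u := by
    rw [RingHom.id_apply, ← MemLp.toLp_const_smul]
    refine MemLp.toLp_congr _ _ ?_
    rw [← weightedDiff_smul]
    exact weightedDiff_congr (coe_smul c u)
  norm_map' u := by
    change ‖(memLp_weightedDiff u).toLp (weightedDiff K u)‖ = ‖u‖
    rw [← sq_eq_sq₀ (norm_nonneg _) (norm_nonneg _), norm_sq_L2, norm_sq_eq_integral]
    refine integral_congr_ae ?_
    filter_upwards [(memLp_weightedDiff u).coeFn_toLp] with p hp
    rw [hp]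

lemma coeFn_weightedDiffL2 (u : X0 h) : weightedDiffL2 h u =ᵐ[volume] weightedDiff K u :=
  MemLp.coeFn_toLp (memLp_weightedDiff u)

/-- `X₀` is a Hilbert space. A Cauchy sequence converges in `L²(ℝⁿ)` and its weighted differences
converge in `L²(ℝⁿ × ℝⁿ)`; almost everywhere convergence along a subsequence identifies the second
limit with the weighted difference of the first. -/
instance instCompleteSpace : CompleteSpace (X0 h) := by
  refine Metric.complete_of_cauchySeq_tendsto fun u hu => ?_
  obtain ⟨C, -, hle⟩ := exists_norm_toL2_le h
  have hu2 : CauchySeq fun j => toL2 h (u j) :=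
    hu.map ((toL2 h).mkContinuous C hle).uniformContinuous
  have huW : CauchySeq fun j => weightedDiffL2 h (u j) :=
    hu.map (weightedDiffL2 h).isometry.uniformContinuous
  obtain ⟨U, hU⟩ := cauchySeq_tendsto_of_complete hu2
  obtain ⟨V, hV⟩ := cauchySeq_tendsto_of_complete huW
  obtain ⟨φ, hφ, hφae⟩ := (tendstoInMeasure_of_tendsto_Lp hU).exists_seq_tendsto_ae'
  obtain ⟨ψ, hψ, hψae⟩ :=
    (tendstoInMeasure_of_tendsto_Lp (hV.comp hφ)).exists_seq_tendsto_ae'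
  have hUae : ∀ᵐ x, Tendsto (fun j => u (φ (ψ j)) x) atTop (𝓝 (U x)) := by
    filter_upwards [hφae, ae_all_iff.2 fun j => coeFn_toL2 (u j)] with x hx hxj
    simp only [hxj] at hx
    exact hx.comp hψ
  have hVU : V =ᵐ[volume] weightedDiff K U := by
    have h1 : ∀ᵐ p : Rn n × Rn n, Tendsto (fun j => u (φ (ψ j)) p.1) atTop (𝓝 (U p.1)) :=
      (Measure.quasiMeasurePreserving_fst (μ := (volume : Measure (Rn n)))
        (ν := (volume : Measure (Rn n)))).ae hUae
    have h2 : ∀ᵐ p : Rn n × Rn n, Tendsto (fun j => u (φ (ψ j)) p.2) atTop (𝓝 (U p.2)) :=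
      (Measure.quasiMeasurePreserving_snd (μ := (volume : Measure (Rn n)))
        (ν := (volume : Measure (Rn n)))).ae hUae
    filter_upwards [h1, h2, hψae, ae_all_iff.2 fun j => coeFn_weightedDiffL2 (u j)]
      with p hp1 hp2 hp3 hp4
    simp only [Function.comp_apply, hp4] at hp3
    exact tendsto_nhds_unique hp3 ((hp1.sub hp2).mul_const _)
  have hmem : U.1 ∈ X0Submodule Ω K := by
    refine ⟨(Lp.memLp U).restrict _, ?_, ?_⟩
    · exact ((memLp_congr_ae hVU).1 (Lp.memLp V)).restrict _
    · rw [ae_restrict_iff' h.isOpen.measurableSet.compl]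
      filter_upwards [hUae, ae_all_iff.2 fun j => ae_zero (u j)] with x hx hx0 hxΩ
      simp only [hx0 _ hxΩ] at hx
      exact tendsto_nhds_unique hx tendsto_const_nhds
  let v : X0 h := ⟨U.1, hmem⟩
  have hv : weightedDiffL2 h v = V :=
    Lp.ext ((coeFn_weightedDiffL2 v).trans hVU.symm)
  refine ⟨v, (weightedDiffL2 h).isometry.isUniformInducing.isInducing.tendsto_nhds_iff.2 ?_⟩
  rw [hv]
  exact hV

end X0
end Completeness

/-! ### Compactness of the embedding -/

section Compactness

/-- A bounded sequence in a separable Hilbert space has a weakly convergent subsequence. -/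
lemma exists_subseq_tendsto_inner {H : Type*} [NormedAddCommGroup H] [InnerProductSpace ℝ H]
    [TopologicalSpace.SeparableSpace H] {x : ℕ → H} {M : ℝ} (hx : ∀ j, ‖x j‖ ≤ M) :
    ∃ φ : ℕ → ℕ, StrictMono φ ∧
      ∀ z : H, ∃ c : ℝ, Tendsto (fun j => inner ℝ (x (φ j)) z) atTop (𝓝 c) := by
  obtain ⟨y, -, φ, hφ, hlim⟩ := WeakDual.isSeqCompact_closedBall ℝ H 0 M
    (x := fun j => StrongDual.toWeakDual (innerSL ℝ (x j))) (fun j => by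
      simpa using hx j)
  refine ⟨φ, hφ, fun z => ⟨y z, ?_⟩⟩
  exact ((WeakDual.eval_continuous z).tendsto y).comp hlim

variable {n : ℕ} {s : ℝ} {Ω : Set (Rn n)} {K : Rn n → ℝ} {h : Standing n s Ω K}

namespace X0

lemma integrableOn_ball (u : X0 h) (x : Rn n) (ρ : ℝ) : IntegrableOn u (Metric.ball x ρ) :=
  (((memLp_two u).locallyIntegrable (by norm_num)).integrableOn_isCompact
    (isCompact_closedBall x ρ)).mono_set Metric.ball_subset_closedBall

/-- A bounded family in `X₀` whose averages over balls tend to zero tends to zero in `L²(Ω)`: the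
oscillation around the averages is uniformly small for small radii, and for a fixed radius the
averages are uniformly bounded. -/
lemma tendsto_integral_sq {ι : Type*} {l : Filter ι} [l.IsCountablyGenerated] {w : ι → X0 h}
    {M : ℝ} (hM : ∀ i, ‖w i‖ ≤ M)
    (hav : ∀ x ρ, 0 < ρ → Tendsto (fun i => ⨍ y in Metric.ball x ρ, w i y) l (𝓝 0)) :
    Tendsto (fun i => ∫ x in Ω, w i x ^ 2) l (𝓝 0) := by
  obtain ⟨θ, hθ, hK⟩ := h.kernel_lower
  obtain ⟨C, hC, hCle⟩ := exists_integral_sq_le h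
  have hω := unitBallVolume_pos (n := n)
  have hs := h.s_pos
  have hfin := h.isFiniteMeasure
  set A : ℝ := (θ * unitBallVolume n)⁻¹ with hA
  have hA0 : 0 < A := by positivity
  have hsq : ∀ i, Integrable fun x => w i x ^ 2 := fun i => (memLp_two (w i)).integrable_sq
  have hbd : ∀ ρ, 0 < ρ → ∀ i x, (⨍ y in Metric.ball x ρ, w i y) ^ 2 ≤
      (ρ ^ n * unitBallVolume n)⁻¹ * (C * M) ^ 2 := by
    intro ρ hρ i x
    have h1 := abs_setAverage_rpow_le (p := 2) one_le_two (v := w i)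
      (by simpa using hsq i) x hρ (integrableOn_ball (w i) x ρ)
    simp only [Real.rpow_two, sq_abs] at h1
    refine h1.trans (mul_le_mul_of_nonneg_left ((hCle (w i)).trans ?_) (by positivity))
    have := hM i
    gcongr
  have havm : ∀ ρ, 0 < ρ → ∀ i, Integrable
      (fun x => (⨍ y in Metric.ball x ρ, w i y) ^ 2) (volume.restrict Ω) := by
    intro ρ hρ i
    refine Integrable.of_bound ((stronglyMeasurable_setAverage_ball (memLp_two (w i)).1
      hρ).aestronglyMeasurable.pow 2) ((ρ ^ n * unitBallVolume n)⁻¹ * (C * M) ^ 2)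
      (Eventually.of_forall fun x => ?_)
    rw [Real.norm_of_nonneg (sq_nonneg _)]
    exact hbd ρ hρ i x
  have hmain : ∀ ρ, 0 < ρ → ∀ i, ∫ x in Ω, w i x ^ 2 ≤
      2 * A * ρ ^ (2 * s) * M ^ 2 + 2 * ∫ x in Ω, (⨍ y in Metric.ball x ρ, w i y) ^ 2 := by
    intro ρ hρ i
    have hL := (integrable_localEnergy (w i)).const_mul (2 * A * ρ ^ (2 * s))
    have hle : ∫ x in Ω, w i x ^ 2 ≤ ∫ x in Ω, (2 * A * ρ ^ (2 * s) * localEnergy K (w i) x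
        + 2 * (⨍ y in Metric.ball x ρ, w i y) ^ 2) := by
      refine integral_mono_ae (hsq i).restrict (hL.restrict.add ((havm ρ hρ i).const_mul 2)) ?_
      filter_upwards [ae_restrict_of_ae
        (sq_sub_setAverage_le hθ hK (w i) LipschitzWith.id rfl)] with x hx
      have h1 := hx ρ hρ
      simp only [id] at h1
      nlinarith [sq_nonneg (w i x - 2 * ⨍ y in Metric.ball x ρ, w i y)]
    rw [integral_add hL.restrict ((havm ρ hρ i).const_mul 2), integral_const_mul] at hle
    refine hle.trans (add_le_add ?_ (le_of_eq (integral_const_mul _ _)))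
    rw [← integral_const_mul]
    refine (setIntegral_le_integral hL (Eventually.of_forall fun x => ?_)).trans ?_
    · have := localEnergy_nonneg (K := K) (w i) x
      simp only [Pi.zero_apply]
      positivity
    · rw [integral_const_mul, integral_localEnergy]
      have := hM i
      gcongr
  have hlim : ∀ ρ, 0 < ρ →
      Tendsto (fun i => ∫ x in Ω, (⨍ y in Metric.ball x ρ, w i y) ^ 2) l (𝓝 0) := by
    intro ρ hρ
    have := tendsto_integral_filter_of_dominated_convergence (μ := volume.restrict Ω) (l := l)
      (F := fun i x => (⨍ y in Metric.ball x ρ, w i y) ^ 2) (f := fun _ => (0 : ℝ))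
      (fun _ => (ρ ^ n * unitBallVolume n)⁻¹ * (C * M) ^ 2)
      (Eventually.of_forall fun i => (havm ρ hρ i).1)
      (Eventually.of_forall fun i => Eventually.of_forall fun x => by
        rw [Real.norm_of_nonneg (sq_nonneg _)]
        exact hbd ρ hρ i x) (integrable_const _)
      (Eventually.of_forall fun x => by simpa using (hav x ρ hρ).pow 2)
    simpa using this
  have hpow : Tendsto (fun ρ : ℝ => 2 * A * ρ ^ (2 * s) * M ^ 2) (𝓝[>] 0) (𝓝 0) := by
    have h1 : Tendsto (fun ρ : ℝ => ρ ^ (2 * s)) (𝓝 0) (𝓝 0) := by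
      have := (Real.continuousAt_rpow_const (0 : ℝ) (2 * s) (Or.inr (by positivity))).tendsto
      rwa [Real.zero_rpow (by positivity)] at this
    have := ((h1.const_mul (2 * A)).mul_const (M ^ 2)).mono_left
      (nhdsWithin_le_nhds (s := Ioi (0 : ℝ)))
    simpa using this
  refine tendsto_order.2 ⟨fun a ha => Eventually.of_forall fun i => ha.trans_le
    (integral_nonneg fun x => sq_nonneg _), fun ε hε => ?_⟩
  obtain ⟨ρ, hρε, hρ⟩ := ((hpow.eventually (gt_mem_nhds (half_pos hε))).and
    self_mem_nhdsWithin).exists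
  have hρ0 : 0 < ρ := hρ
  filter_upwards [(hlim ρ hρ0).eventually (gt_mem_nhds (show 0 < ε / 4 by positivity))] with i hi
  have := hmain ρ hρ0 i
  linarith

/-- Convergence to zero in `L²(Ω)` improves to convergence in `L^q(Ω)` for subcritical `q`, since
the family is bounded in `L^{2*}(Ω)`. -/
lemma tendsto_integral_rpow {ι : Type*} {l : Filter ι} {w : ι → X0 h}
    {M q : ℝ} (hM : ∀ i, ‖w i‖ ≤ M) (hq : 2 ≤ q) (hqp : q < criticalExponent n s)
    (h2 : Tendsto (fun i => ∫ x in Ω, w i x ^ 2) l (𝓝 0)) :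
    Tendsto (fun i => ∫ x in Ω, |w i x| ^ q) l (𝓝 0) := by
  have hp2 := h.two_lt_criticalExponent
  set p := criticalExponent n s with hp
  obtain ⟨C, hC, hCle⟩ := exists_integral_rpow_le h (r := p) (by linarith) le_rfl
  have hint : ∀ i (r : ℝ), 0 < r → r ≤ p → IntegrableOn (fun x => |w i x| ^ r) Ω :=
    fun i r hr hrp => integrableOn_rpow hr hrp (w i)
  refine tendsto_order.2 ⟨fun a ha => Eventually.of_forall fun i => ha.trans_le
    (integral_nonneg fun x => Real.rpow_nonneg (abs_nonneg _) _), fun ε hε => ?_⟩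
  set B : ℝ := (C * |M|) ^ p with hB
  have hB0 : 0 ≤ B := by positivity
  obtain ⟨D, hD, hDle⟩ := exists_rpow_le_mul_rpow_add hq hqp
    (δ := ε / (2 * (B + 1))) (by positivity)
  filter_upwards [h2.eventually (gt_mem_nhds (show 0 < ε / (2 * D) by positivity))] with i hi
  have h1 : ∫ x in Ω, |w i x| ^ q ≤
      ∫ x in Ω, (ε / (2 * (B + 1)) * |w i x| ^ p + D * |w i x| ^ (2 : ℝ)) := by
    refine integral_mono (hint i q (by linarith) hqp.le)
      (((hint i p (by linarith) le_rfl).const_mul _).add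
        ((hint i 2 (by norm_num) hp2.le).const_mul _)) fun x => ?_
    rcases (abs_nonneg (w i x)).eq_or_lt with h0 | h0
    · simp only [← h0]
      rw [Real.zero_rpow (by linarith), Real.zero_rpow (by linarith), Real.zero_rpow (by norm_num)]
      simp
    · exact hDle _ h0
  rw [integral_add ((hint i p (by linarith) le_rfl).const_mul _)
    ((hint i 2 (by norm_num) hp2.le).const_mul _), integral_const_mul, integral_const_mul] at h1
  simp only [Real.rpow_two, sq_abs] at h1
  have h3 : ∫ x in Ω, |w i x| ^ p ≤ B := by
    refine (hCle (w i)).trans (Real.rpow_le_rpow (by positivity) ?_ (by linarith))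
    have := (hM i).trans (le_abs_self M)
    gcongr
  have h4 : ε / (2 * (B + 1)) * ∫ x in Ω, |w i x| ^ p ≤ ε / 2 := by
    refine (mul_le_mul_of_nonneg_left (h3.trans (le_add_of_nonneg_right zero_le_one))
      (by positivity)).trans (le_of_eq ?_)
    field_simp
  have h5 : D * ∫ x in Ω, w i x ^ 2 < ε / 2 := by
    refine (mul_lt_mul_of_pos_left hi hD).trans_le (le_of_eq ?_)
    field_simp
  linarith

lemma setAverage_ball_eq_inner (u : X0 h) (x : Rn n) (ρ : ℝ) :
    ⨍ y in Metric.ball x ρ, u y = (volume.real (Metric.ball x ρ))⁻¹ *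
      inner ℝ (toL2 h u) (indicatorConstLp 2 (measurableSet_ball (x := x) (ε := ρ))
        measure_ball_lt_top.ne (1 : ℝ)) := by
  rw [real_inner_comm, L2.inner_indicatorConstLp_one, setAverage_eq, smul_eq_mul]
  congr 1
  refine integral_congr_ae (ae_restrict_of_ae ?_)
  filter_upwards [coeFn_toL2 u] with y hy
  rw [hy]

/-- The compact embedding of `X₀` in `L^q(Ω)` for subcritical `q`: every bounded sequence has a
subsequence which is a Cauchy sequence in `L^q(Ω)`. The subsequence is chosen weakly convergent in
`L²(ℝⁿ)`, so that its averages over balls converge. -/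
theorem exists_subseq_cauchySeq {q : ℝ} (hq : 2 ≤ q) (hqp : q < criticalExponent n s)
    [Fact (1 ≤ ENNReal.ofReal q)] {u : ℕ → X0 h} {M : ℝ} (hM : ∀ j, ‖u j‖ ≤ M) :
    ∃ φ : ℕ → ℕ, StrictMono φ ∧
      CauchySeq fun j => toLpLinear h (zero_lt_two.trans_le hq) hqp.le (u (φ j)) := by
  obtain ⟨C, hC, hCle⟩ := exists_norm_toL2_le h
  have : Fact ((2 : ENNReal) ≠ ⊤) := ⟨by norm_num⟩
  obtain ⟨φ, hφ, hlim⟩ := exists_subseq_tendsto_inner (x := fun j => toL2 h (u j)) (M := C * M)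
    fun j => (hCle _).trans (mul_le_mul_of_nonneg_left (hM j) hC)
  refine ⟨φ, hφ, ?_⟩
  -- The Cauchy property is the convergence to zero of the family of differences.
  let w : ℕ × ℕ → X0 h := fun i => u (φ i.1) - u (φ i.2)
  have hwM : ∀ i, ‖w i‖ ≤ M + M := fun i =>
    (norm_sub_le _ _).trans (add_le_add (hM _) (hM _))
  have hav : ∀ x ρ, 0 < ρ →
      Tendsto (fun i => ⨍ y in Metric.ball x ρ, w i y) atTop (𝓝 0) := by
    intro x ρ hρ
    obtain ⟨c, hc⟩ := hlim (indicatorConstLp 2 (measurableSet_ball (x := x) (ε := ρ))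
        measure_ball_lt_top.ne (1 : ℝ))
    have h1 : Tendsto (fun i : ℕ × ℕ => i.1) atTop atTop := by
      rw [← prod_atTop_atTop_eq]; exact tendsto_fst
    have h2 : Tendsto (fun i : ℕ × ℕ => i.2) atTop atTop := by
      rw [← prod_atTop_atTop_eq]; exact tendsto_snd
    have h3 := ((hc.comp h1).sub (hc.comp h2)).const_mul (volume.real (Metric.ball x ρ))⁻¹
    rw [sub_self, mul_zero] at h3
    refine h3.congr fun i => ?_
    rw [setAverage_ball_eq_inner, map_sub, inner_sub_left]
    rfl
  have hq' := tendsto_integral_rpow hwM hq hqp (tendsto_integral_sq hwM hav)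
  rw [cauchySeq_iff_tendsto_dist_atTop_0]
  have hroot := hq'.rpow_const (p := q⁻¹) (Or.inr (by positivity))
  rw [Real.zero_rpow (by positivity)] at hroot
  refine hroot.congr fun i => ?_
  rw [integral_rpow_eq_norm_toLpLinear (by linarith) hqp.le, ← Real.rpow_mul (norm_nonneg _),
    mul_inv_cancel₀ (by positivity), Real.rpow_one, dist_eq_norm, ← map_sub]

end X0
end Compactness

/-! ### The energy functional -/

section Energy

variable {n : ℕ} {s : ℝ} {Ω : Set (Rn n)} {K : Rn n → ℝ} {h : Standing n s Ω K}
  {q : ℝ} {f : Rn n → ℝ → ℝ} {lam : ℝ}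

lemma GrowthFunction.integral_abs_rpow_le {a b : ℝ} {g : Rn n → ℝ → ℝ} {μ : Measure (Rn n)}
    [IsFiniteMeasure μ] (hg : GrowthFunction q a b g) (hq : 1 < q) {w : Rn n → ℝ}
    (hw : Integrable (fun x => |w x| ^ q) μ) :
    ∫ x, |g x (w x)| ^ q.conjExponent ∂μ ≤
      (a + b) ^ q.conjExponent * (μ.real univ + ∫ x, |w x| ^ q ∂μ) := by
  have hc := Real.HolderConjugate.conjExponent hq
  have hab : 0 ≤ a + b := add_nonneg hg.nonneg_left hg.nonneg_right
  have hle : ∀ x, |g x (w x)| ^ q.conjExponent ≤ (a + b) ^ q.conjExponent * (1 + |w x| ^ q) := by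
    intro x
    have hm : 1 ≤ max 1 |w x| := le_max_left _ _
    have h1 : |g x (w x)| ≤ (a + b) * max 1 |w x| ^ (q - 1) := by
      have e1 : |w x| ^ (q - 1) ≤ max 1 |w x| ^ (q - 1) :=
        Real.rpow_le_rpow (abs_nonneg _) (le_max_right _ _) (by linarith)
      have e2 : 1 ≤ max 1 |w x| ^ (q - 1) := Real.one_le_rpow hm (by linarith)
      have := hg.growth x (w x)
      nlinarith [hg.nonneg_left, hg.nonneg_right]
    have h2 : max 1 |w x| ^ q ≤ 1 + |w x| ^ q := by
      have := Real.rpow_nonneg (abs_nonneg (w x)) q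
      rcases max_choice 1 |w x| with e | e <;> rw [e]
      · rw [Real.one_rpow]; linarith
      · linarith
    calc _ ≤ ((a + b) * max 1 |w x| ^ (q - 1)) ^ q.conjExponent :=
          Real.rpow_le_rpow (abs_nonneg _) h1 hc.symm.nonneg
      _ = (a + b) ^ q.conjExponent * max 1 |w x| ^ q := by
          rw [Real.mul_rpow hab (by positivity), ← Real.rpow_mul (by positivity),
            hc.sub_one_mul_conj]
      _ ≤ _ := mul_le_mul_of_nonneg_left h2 (by positivity)
  have hi : Integrable (fun x => 1 + |w x| ^ q) μ := (integrable_const 1).add hw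
  have := integral_mono_of_nonneg (Eventually.of_forall fun x => Real.rpow_nonneg (abs_nonneg _) _)
    (hi.const_mul ((a + b) ^ q.conjExponent)) (Eventually.of_forall hle)
  refine this.trans (le_of_eq ?_)
  rw [integral_const_mul, integral_add (integrable_const 1) hw]
  simp

/-- The quadratic term of the energy is absorbed in the nonlinearity: `λ t + f(x, t)` agrees, for
almost every `x ∈ Ω`, with a regular function of the same growth. -/
lemma Nonlinearity.exists_growthFunction (hf : Nonlinearity n s Ω q f) (hlam : 0 < lam) :
    ∃ (a b : ℝ) (g : Rn n → ℝ → ℝ), GrowthFunction q a b g ∧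
      ∀ᵐ x ∂(volume.restrict Ω), (∀ t, g x t = lam * t + f x t) ∧
        ∀ t, primitive g x t = lam / 2 * t ^ 2 + primitive f x t := by
  obtain ⟨a, b, ha, hb, hgr⟩ := hf.growth
  have hq := hf.two_lt
  obtain ⟨g, hg, hgf⟩ := NonlocalProblem.exists_growthFunction (μ := volume.restrict Ω) (q := q)
    (a := a + lam) (b := b + lam) (f := fun x t => lam * t + f x t) (by positivity) (by positivity)
    (fun t => (hf.measurable t).const_add _)
    (hf.continuous.mono fun x hx => (continuous_const.mul continuous_id).add hx)
    (hgr.mono fun x hx t => by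
      have h1 : |t| ≤ 1 + |t| ^ (q - 1) := by
        rcases le_total |t| 1 with ht | ht
        · linarith [Real.rpow_nonneg (abs_nonneg t) (q - 1)]
        · have := Real.rpow_le_rpow_of_exponent_le ht (show 1 ≤ q - 1 by linarith)
          rw [Real.rpow_one] at this
          linarith
      have h2 := abs_add_le (lam * t) (f x t)
      rw [abs_mul, abs_of_pos hlam] at h2
      have := hx t
      nlinarith)
  refine ⟨_, _, g, hg, ?_⟩
  filter_upwards [hgf, hf.continuous] with x hx hxc
  have hgx : g x = fun t => lam * t + f x t := hx.symm
  refine ⟨fun t => by rw [hgx], fun t => ?_⟩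
  have hlin : Continuous fun τ : ℝ => lam * τ := continuous_const.mul continuous_id
  simp only [primitive, hgx]
  rw [intervalIntegral.integral_add (hlin.intervalIntegrable _ _) (hxc.intervalIntegrable _ _),
    intervalIntegral.integral_const_mul, integral_id]
  ring

lemma Nonlinearity.le_criticalExponent (hf : Nonlinearity n s Ω q f) :
    q ≤ criticalExponent n s := hf.lt_critical.le

namespace X0

lemma memLp_of_nonlinearity (hf : Nonlinearity n s Ω q f) (u : X0 h) :
    MemLp u (ENNReal.ofReal q) (volume.restrict Ω) :=
  memLp_of_le_criticalExponent (by linarith [hf.two_lt]) hf.le_criticalExponent u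

variable {a b : ℝ} {g : Rn n → ℝ → ℝ}

lemma integrableOn_primitive (hf : Nonlinearity n s Ω q f) (hg : GrowthFunction q a b g)
    (hgf : ∀ᵐ x ∂(volume.restrict Ω), ∀ t, primitive g x t = lam / 2 * t ^ 2 + primitive f x t)
    (u : X0 h) : IntegrableOn (fun x => primitive f x (u x)) Ω := by
  have hfin := h.isFiniteMeasure
  have h1 := hg.integrable_primitive_comp (by linarith [hf.two_lt]) (memLp_of_nonlinearity hf u)
  have h2 := ((memLp_two u).integrable_sq.restrict (s := Ω)).const_mul (lam / 2)
  refine (h1.sub h2).congr ?_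
  filter_upwards [hgf] with x hx
  simp [hx]

lemma energy_eq (hf : Nonlinearity n s Ω q f) (hg : GrowthFunction q a b g)
    (hgf : ∀ᵐ x ∂(volume.restrict Ω), ∀ t, primitive g x t = lam / 2 * t ^ 2 + primitive f x t)
    (u : X0 h) :
    energy h lam f u = 1 / 2 * ‖u‖ ^ 2 - ∫ x in Ω, primitive g x (u x) := by
  have h2 := ((memLp_two u).integrable_sq.restrict (s := Ω)).const_mul (lam / 2)
  have h3 : ∫ x in Ω, primitive g x (u x) =
      lam / 2 * (∫ x in Ω, u x ^ 2) + ∫ x in Ω, primitive f x (u x) := by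
    rw [← integral_const_mul, ← integral_add h2 (integrableOn_primitive hf hg hgf u)]
    refine integral_congr_ae ?_
    filter_upwards [hgf] with x hx
    exact hx _
  have h4 : ‖u‖ ^ 2 = ∫ p : Rn n × Rn n, |u p.1 - u p.2| ^ 2 * K (p.1 - p.2) := by
    rw [← real_inner_self_eq_norm_sq, inner_def, energyForm]
    simp only [sq_abs]
    simp only [sq]
  rw [energy, h3, ← h4]
  simp only [sq_abs]
  ring

/-- The energy is Fréchet differentiable, with
`J'(u) v = ⟨u, v⟩ - ∫_Ω (λ u + f(x, u)) v`. -/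
lemma exists_hasFDerivAt_energy (hf : Nonlinearity n s Ω q f) (hg : GrowthFunction q a b g)
    (hgf : ∀ᵐ x ∂(volume.restrict Ω), ∀ t, primitive g x t = lam / 2 * t ^ 2 + primitive f x t)
    (u : X0 h) :
    ∃ L : X0 h →L[ℝ] ℝ, HasFDerivAt (energy h lam f) L u ∧
      ∀ v : X0 h, L v = inner ℝ u v - ∫ x in Ω, g x (u x) * v x := by
  have hfin := h.isFiniteMeasure
  have hq : 1 < q := by linarith [hf.two_lt]
  have hq0 : 0 < q := by linarith
  have : Fact (1 ≤ ENNReal.ofReal q) := ⟨by simpa using hq.le⟩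
  obtain ⟨C, -, hC⟩ := exists_norm_toLpLinear_le h hq0 hf.le_criticalExponent
  let T : X0 h →L[ℝ] Lp ℝ (ENNReal.ofReal q) (volume.restrict Ω) :=
    (toLpLinear h hq0 hf.le_criticalExponent).mkContinuous C hC
  have hT : ∀ v : X0 h, T v =ᵐ[volume.restrict Ω] v :=
    fun v => coeFn_toLpLinear hq0 hf.le_criticalExponent v
  obtain ⟨N, hN, hNv⟩ := hg.exists_hasFDerivAt_integral_primitive hq (T u)
  refine ⟨innerSL ℝ u - N.comp T, ?_, fun v => ?_⟩
  · have h1 : HasFDerivAt (fun u : X0 h => 1 / 2 * ‖u‖ ^ 2) (innerSL ℝ u) u := by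
      have := ((hasStrictFDerivAt_norm_sq u).hasFDerivAt).const_mul (1 / 2 : ℝ)
      refine this.congr_fderiv ?_
      ext v
      simp
    refine (h1.sub (hN.comp u T.hasFDerivAt)).congr_of_eventuallyEq
      (Eventually.of_forall fun v => ?_)
    rw [energy_eq hf hg hgf]
    simp only [Pi.sub_apply, Function.comp_apply]
    congr 1
    refine integral_congr_ae ?_
    filter_upwards [hT v] with x hx
    rw [hx]
  · rw [sub_apply, ContinuousLinearMap.comp_apply, hNv, innerSL_apply_apply]
    congr 1
    refine integral_congr_ae ?_
    filter_upwards [hT v, hT u] with x hx hxu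
    rw [hx, hxu]

/-- By the Ambrosetti–Rabinowitz condition and the lower bound on the primitive, the integrand
which remains in `J(u) - κ J'(u) u`, for `1 / q < κ < 1 / 2`, is bounded from below. -/
lemma exists_neg_le_sub (hf : Nonlinearity n s Ω q f) (hlam : 0 < lam)
    (hgf : ∀ᵐ x ∂(volume.restrict Ω), (∀ t, g x t = lam * t + f x t) ∧
        ∀ t, primitive g x t = lam / 2 * t ^ 2 + primitive f x t) :
    ∃ κ D : ℝ, 0 < κ ∧ κ < 1 / 2 ∧
      ∀ᵐ x ∂(volume.restrict Ω), ∀ t, -D ≤ κ * (g x t * t) - primitive g x t := by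
  have hq := hf.two_lt
  have hq0 : 0 < q := by linarith
  have hinv : 1 / q < 1 / 2 := one_div_lt_one_div_of_lt two_pos hq
  -- `κ < 1 / 2` keeps a positive multiple of `‖u‖²`, and `κ > 1 / q` a positive multiple of the
  -- primitive, whose growth of order `q > 2` absorbs the quadratic term.
  obtain ⟨κ, hκ1, hκ2⟩ := exists_between hinv
  have hκ0 : 0 < κ := (by positivity : 0 < 1 / q).trans hκ1
  obtain ⟨a₃, a₄, ha₃, ha₄, hlow⟩ := hf.primitive_lower
  have hκq : 0 < κ * q - 1 := by
    rw [div_lt_iff₀ hq0] at hκ1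
    linarith
  set e : ℝ := (1 / 2 - κ) * lam with he
  have he0 : 0 < e := mul_pos (by linarith) hlam
  obtain ⟨C, hC, hCle⟩ := exists_rpow_le_mul_rpow_add (a := 0) (b := 2) (c := q) zero_le_two hq
    (δ := (κ * q - 1) * a₃ / e) (by positivity)
  refine ⟨κ, e * C + (κ * q - 1) * a₄, hκ0, hκ2, ?_⟩
  filter_upwards [hgf, hf.superlinear, hlow] with x hx hsup hl t
  rw [hx.1, hx.2]
  rcases eq_or_ne t 0 with rfl | ht
  · have : 0 ≤ e * C + (κ * q - 1) * a₄ := by positivity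
    simp only [primitive, intervalIntegral.integral_same]
    linarith
  have h1 := (hsup t ht).2
  have h2 := hl t
  have h3 := hCle |t| (abs_pos.2 ht)
  rw [Real.rpow_zero, Real.rpow_two, sq_abs] at h3
  have h4 := mul_le_mul_of_nonneg_left h3 he0.le
  have h5 : e * ((κ * q - 1) * a₃ / e * |t| ^ q + C * 1) =
      (κ * q - 1) * (a₃ * |t| ^ q) + e * C := by field_simp
  rw [h5, he] at h4
  have h6 := mul_le_mul_of_nonneg_left h2 hκq.le
  have h7 := mul_le_mul_of_nonneg_left h1 hκ0.le
  nlinarith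

/-- The energy and the norm of its derivative control the norm of `X₀`. -/
lemma exists_norm_sq_le (h : Standing n s Ω K) (hf : Nonlinearity n s Ω q f) (hlam : 0 < lam) :
    ∃ c D : ℝ, 0 < c ∧ 0 ≤ D ∧ ∀ u : X0 h,
      c * ‖u‖ ^ 2 ≤ |energy h lam f u| + ‖fderiv ℝ (energy h lam f) u‖ * ‖u‖ + D := by
  obtain ⟨a, b, g, hg, hgf⟩ := hf.exists_growthFunction hlam
  obtain ⟨κ, D, hκ0, hκ2, hD⟩ := exists_neg_le_sub hf hlam hgf
  have hgf' := hgf.mono fun x hx => hx.2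
  have hfin := h.isFiniteMeasure
  have hq : 1 < q := by linarith [hf.two_lt]
  refine ⟨1 / 2 - κ, |D| * volume.real Ω, by linarith, by positivity, fun u => ?_⟩
  obtain ⟨L, hL, hLv⟩ := exists_hasFDerivAt_energy hf hg hgf' u
  rw [hL.fderiv]
  have hu := memLp_of_nonlinearity hf u
  have i1 := (hg.integrable_comp_mul hq hu hu).const_mul κ
  have i2 := hg.integrable_primitive_comp hq hu
  have h1 : ∫ _ in Ω, -|D| ≤ ∫ x in Ω, (κ * (g x (u x) * u x) - primitive g x (u x)) := by
    refine integral_mono_ae (integrable_const _) (i1.sub i2) ?_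
    filter_upwards [hD] with x hx
    linarith [hx (u x), le_abs_self D]
  rw [integral_sub i1 i2, integral_const_mul, setIntegral_const, smul_eq_mul] at h1
  have h2 := hLv u
  rw [real_inner_self_eq_norm_sq] at h2
  have h3 := energy_eq hf hg hgf' u
  have h4 : |L u| ≤ ‖L‖ * ‖u‖ := L.le_opNorm u
  have h5 : -(κ * L u) ≤ ‖L‖ * ‖u‖ := by
    have := neg_abs_le (L u)
    nlinarith [abs_nonneg (L u)]
  have h6 := le_abs_self (energy h lam f u)
  nlinarith

lemma exists_norm_le_of_isPalaisSmaleSeq (hf : Nonlinearity n s Ω q f) (hlam : 0 < lam) {c : ℝ}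
    {u : ℕ → X0 h} (hu : IsPalaisSmaleSeq (energy h lam f) c u) : ∃ M, ∀ j, ‖u j‖ ≤ M := by
  obtain ⟨e, D, he, hD, hle⟩ := exists_norm_sq_le h hf hlam
  obtain ⟨B₁, hB₁⟩ := hu.1.abs.bddAbove_range
  obtain ⟨B₂, hB₂⟩ := hu.2.bddAbove_range
  refine ⟨(B₁ + B₂ + D) / e + 1, fun j => ?_⟩
  have h1 : |energy h lam f (u j)| ≤ B₁ := hB₁ ⟨j, rfl⟩
  have h2 : ‖fderiv ℝ (energy h lam f) (u j)‖ ≤ B₂ := hB₂ ⟨j, rfl⟩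
  have hB10 : 0 ≤ B₁ := (abs_nonneg _).trans h1
  have hB20 : 0 ≤ B₂ := (norm_nonneg (fderiv ℝ (energy h lam f) (u j))).trans h2
  rcases le_total ‖u j‖ 1 with hj | hj
  · have : 0 ≤ (B₁ + B₂ + D) / e := by positivity
    linarith
  · have h3 := hle (u j)
    have h4 := mul_le_mul_of_nonneg_right h2 (norm_nonneg (u j))
    have h5 : e * ‖u j‖ * ‖u j‖ ≤ (B₁ + B₂ + D) * ‖u j‖ := by nlinarith
    have h6 := le_of_mul_le_mul_right h5 (by linarith)
    have h7 : ‖u j‖ ≤ (B₁ + B₂ + D) / e := by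
      rw [le_div_iff₀ he]; linarith
    linarith

/-- Subtracting the expressions of `J'(u_j)` and `J'(u_k)`, applied to `u_j - u_k`, leaves
`‖u_j - u_k‖²` and a term which is small when `u_j - u_k` is small in `L^q(Ω)`. Hence a bounded
Palais–Smale sequence which is Cauchy in `L^q(Ω)` is Cauchy in `X₀`. -/
theorem palaisSmaleCondition_energy (hf : Nonlinearity n s Ω q f) (hlam : 0 < lam) (c : ℝ) :
    PalaisSmaleCondition (energy h lam f) c := by
  intro u hu
  obtain ⟨M, hM⟩ := exists_norm_le_of_isPalaisSmaleSeq hf hlam hu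
  obtain ⟨a, b, g, hg, hgf⟩ := hf.exists_growthFunction hlam
  have hgf' := hgf.mono fun x hx => hx.2
  have hfin := h.isFiniteMeasure
  have hq : 1 < q := by linarith [hf.two_lt]
  have hq0 : 0 < q := by linarith
  have : Fact (1 ≤ ENNReal.ofReal q) := ⟨by simpa using hq.le⟩
  obtain ⟨φ, hφ, hcau⟩ := exists_subseq_cauchySeq hf.two_lt.le hf.lt_critical hM
  have hqp := hf.le_criticalExponent
  obtain ⟨C, hC, hCle⟩ := exists_integral_rpow_le h hq hqp
  choose L hL hLv using fun v : X0 h => exists_hasFDerivAt_energy hf hg hgf' v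
  set p := q.conjExponent with hp
  have hp0 : 0 < p := (Real.HolderConjugate.conjExponent hq).symm.pos
  set B : ℝ := ((a + b) ^ p * (volume.real Ω + (C * M) ^ q)) ^ (1 / p) with hB
  have hab : 0 ≤ a + b := add_nonneg hg.nonneg_left hg.nonneg_right
  have hgB : ∀ (j : ℕ) (v : X0 h),
      |∫ x in Ω, g x (u j x) * v x| ≤ B * ‖toLpLinear h hq0 hqp v‖ := by
    intro j v
    have h1 := abs_integral_mul_le hq (hg.memLp_comp hq (memLp_of_nonlinearity hf (u j)))
      (toLpLinear h hq0 hqp v)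
    have h2 : ∫ x in Ω, g x (u j x) * v x =
        ∫ x in Ω, g x (u j x) * toLpLinear h hq0 hqp v x := by
      refine integral_congr_ae ?_
      filter_upwards [coeFn_toLpLinear hq0 hqp v] with x hx
      rw [hx]
    rw [h2]
    refine h1.trans (mul_le_mul_of_nonneg_right ?_ (norm_nonneg _))
    refine Real.rpow_le_rpow (integral_nonneg fun x => Real.rpow_nonneg (abs_nonneg _) _) ?_
      (by positivity)
    refine (hg.integral_abs_rpow_le hq (integrableOn_rpow hq0 hqp (u j))).trans ?_
    rw [measureReal_restrict_apply_univ]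
    have h3 := hCle (u j)
    have h4 : (C * ‖u j‖) ^ q ≤ (C * M) ^ q :=
      Real.rpow_le_rpow (by positivity) (mul_le_mul_of_nonneg_left (hM j) hC) hq0.le
    gcongr
    exact h3.trans h4
  have key : ∀ j k, ‖u j - u k‖ ^ 2 ≤ (‖fderiv ℝ (energy h lam f) (u j)‖ +
      ‖fderiv ℝ (energy h lam f) (u k)‖) * (M + M) +
      2 * B * dist (toLpLinear h hq0 hqp (u j)) (toLpLinear h hq0 hqp (u k)) := by
    intro j k
    set v := u j - u k with hv
    have hvM : ‖v‖ ≤ M + M := (norm_sub_le _ _).trans (add_le_add (hM _) (hM _))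
    rw [(hL (u j)).fderiv, (hL (u k)).fderiv, dist_eq_norm, ← map_sub, ← hv]
    have e1 : ‖v‖ ^ 2 = L (u j) v - L (u k) v
        + (∫ x in Ω, g x (u j x) * v x) - ∫ x in Ω, g x (u k x) * v x := by
      rw [hLv, hLv, ← real_inner_self_eq_norm_sq]
      nth_rewrite 1 [hv]
      rw [inner_sub_left]
      ring
    have e2 := (le_abs_self _).trans ((L (u j)).le_opNorm v)
    have e3 := (neg_le_abs _).trans ((L (u k)).le_opNorm v)
    have e4 := (le_abs_self _).trans (hgB j v)
    have e5 := (neg_le_abs _).trans (hgB k v)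
    have e6 := mul_le_mul_of_nonneg_left hvM
      (add_nonneg (norm_nonneg (L (u j))) (norm_nonneg (L (u k))))
    linarith
  refine ⟨φ, ?_⟩
  have hX : CauchySeq fun j => u (φ j) := by
    rw [cauchySeq_iff_tendsto_dist_atTop_0] at hcau ⊢
    have h1 : Tendsto (fun i : ℕ × ℕ => φ i.1) atTop atTop := by
      rw [← prod_atTop_atTop_eq]; exact hφ.tendsto_atTop.comp tendsto_fst
    have h2 : Tendsto (fun i : ℕ × ℕ => φ i.2) atTop atTop := by
      rw [← prod_atTop_atTop_eq]; exact hφ.tendsto_atTop.comp tendsto_snd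
    have h3 := (((hu.2.comp h1).add (hu.2.comp h2)).mul_const (M + M)).add
      (hcau.const_mul (2 * B))
    simp only [add_zero, zero_mul, mul_zero] at h3
    have h4 : Tendsto (fun i : ℕ × ℕ => ‖u (φ i.1) - u (φ i.2)‖ ^ 2) atTop (𝓝 0) :=
      squeeze_zero (fun i => sq_nonneg _) (fun i => key _ _) h3
    have h5 := h4.sqrt
    rw [Real.sqrt_zero] at h5
    refine h5.congr fun i => ?_
    rw [Real.sqrt_sq (norm_nonneg _), dist_eq_norm]
  obtain ⟨v, hv⟩ := cauchySeq_tendsto_of_complete hX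
  exact ⟨v, hφ, hv⟩

end X0
end Energy

end NonlocalProblem

theorem proposition3p1 (n : ℕ) (s : ℝ)
    (Ω : Set (NonlocalProblem.Rn n)) (K : NonlocalProblem.Rn n → ℝ)
    (h : NonlocalProblem.Standing n s Ω K)
    (q : ℝ) (f : NonlocalProblem.Rn n → ℝ → ℝ)
    (hf : NonlocalProblem.Nonlinearity n s Ω q f)
    (lam : ℝ) (hlam : 0 < lam) :
    (∀ u : NonlocalProblem.X0 h,
      IntegrableOn (fun x => NonlocalProblem.primitive f x (u x)) Ω) ∧
    Differentiable ℝ (NonlocalProblem.energy h lam f) ∧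
    ∀ c : ℝ, NonlocalProblem.PalaisSmaleCondition (NonlocalProblem.energy h lam f) c := by
  obtain ⟨a, b, g, hg, hgf⟩ := hf.exists_growthFunction hlam
  have hgf' := hgf.mono fun x hx => hx.2
  refine ⟨NonlocalProblem.X0.integrableOn_primitive hf hg hgf', fun u => ?_,
    NonlocalProblem.X0.palaisSmaleCondition_energy hf hlam⟩
  obtain ⟨L, hL, -⟩ := NonlocalProblem.X0.exists_hasFDerivAt_energy hf hg hgf' u
  exact hL.differentiableAt
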